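/- Let $k$ be a field, let $\Omega$ be an algebraically closed field containing $k$, and let $m,A\in k$. Choose $s,w,y\in\Omega$ with $$s^2=m^2-4,\qquad w^2=(m+2+A)^2-4(m-2),\qquad y^2=A^2-4(m-2).$$ Let $T(m,A,x)=p(x)\,\bar p(x)\in k[x]$ be the monic octic with $$p(x)=x^4+(u-u^{-1}-A)x^3+\bigl((2-A)u-A-4\bigr)x^2+(u^2-1-Au)x+u^2,$$ where $u\in\Omega$ is a root of $u^2-mu+1=0$ and $\bar p$ is obtained from $p$ by replacing $u$ with the other root $u^{-1}$; thus $T=p_0^2+m\,p_0p_1+p_1^2$ with $p_0=x^4-(m+A)x^3-(A+4)x^2-2x-1$ and $p_1=2x^3+(2-A)x^2+(m-A)x+m$. Let $L\subseteq\Omega$ be the splitting field of $T(m,A,x)$ over $k$. Let ${}_8T_{11}$ be the transitive permutation group of degree $8$ and order $16$ generated by $$a=(0\,1\,2\,3)(4\,5\,6\,7),\quad b=(4\,6)(5\,7),\quad c=(0\,4)(1\,5)(2\,6)(3\,7);$$ it is the almost extraspecial group of order $16$, with presentation $a^4=b^2=c^2=1$, $ab=ba$, $ac=ca$, $(bc)^2=a^2$.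 Suppose that $E=k(s,w,y)$ has degree $8$ over $k$. Then: (a) $T(m,A,x)$ is irreducible over $k$, $L/k$ is Galois, and $G=\mathrm{Gal}(L/k)$, acting on the eight roots of $T(m,A,x)$, is the permutation group ${}_8T_{11}$ for a suitable numbering of the roots; in particular $|G|=16$. (b) $G$ has exactly one subgroup isomorphic to the quaternion group $Q_8$, and its fixed field is $k(swy)$. (c) $G$ has exactly three subgroups isomorphic to the dihedral group $D_4$ of order $8$, and their fixed fields are $k(s)$, $k(w)$ and $k(y)$. (d) $G$ has exactly three subgroups isomorphic to $C_4\times C_2$, and their fixed fields are $k(sw)$, $k(sy)$ and $k(wy)$. -/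

import Mathlib

open Polynomial IntermediateField

/-- The quartic `p(x)` attached to `A` and a (nonzero) element `u` of a field. -/
noncomputable def quarticFactor {K : Type*} [Field K] (A u : K) : K[X] :=
  X ^ 4 + C (u - u⁻¹ - A) * X ^ 3 + C ((2 - A) * u - A - 4) * X ^ 2
    + C (u ^ 2 - 1 - A * u) * X + C (u ^ 2)

/-- If `u ^ 2 - m * u + 1 = 0`, the quartic `p(x)` has the form `p₀(x) + u * p₁(x)` with `p₀`, `p₁`
having coefficients in `ℤ[m, A]`; this is `p₀`. -/
noncomputable def quarticPart₀ {k : Type*} [Field k] (m A : k) : k[X] :=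
  X ^ 4 - C (m + A) * X ^ 3 - C (A + 4) * X ^ 2 - 2 * X - 1

/-- The coefficient `p₁(x)` of `u` in `p(x) = p₀(x) + u * p₁(x)`. -/
noncomputable def quarticPart₁ {k : Type*} [Field k] (m A : k) : k[X] :=
  2 * X ^ 3 + C (2 - A) * X ^ 2 + C (m - A) * X + C m

/-- The octic `T(m, A, x)`, that is the norm of `p₀ + u * p₁` for `u ^ 2 - m * u + 1 = 0`:
`T = (p₀ + u * p₁) * (p₀ + u⁻¹ * p₁)`, where `u + u⁻¹ = m`. See `octic_map` below. -/
noncomputable def octic {k : Type*} [Field k] (m A : k) : k[X] :=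
  quarticPart₀ m A ^ 2 + C m * quarticPart₀ m A * quarticPart₁ m A + quarticPart₁ m A ^ 2

/-- `p = p₀ + u * p₁`. -/
theorem quarticFactor_eq {K : Type*} [Field K] (m A u : K) (hu : u ^ 2 - m * u + 1 = 0) :
    quarticFactor A u = quarticPart₀ m A + C u * quarticPart₁ m A := by
  have h0 : u ≠ 0 := by
    rintro rfl
    simp at hu
  have hinv : u⁻¹ = m - u := by
    field_simp
    linear_combination hu
  have hsq : u ^ 2 = m * u - 1 := by linear_combination hu
  unfold quarticFactor quarticPart₀ quarticPart₁
  rw [hinv, hsq]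
  simp only [map_sub, map_add, map_mul, map_one, map_ofNat]
  ring

/-- `T = p * p̄` over every extension field `K` of `k` containing a zero `u` of `Y² - mY + 1`;
the conjugate `p̄` of `p` is obtained by replacing `u` with the other zero `u⁻¹`. -/
theorem octic_map {k K : Type*} [Field k] [Field K] [Algebra k K] (m A : k) (u : K)
    (hu : u ^ 2 - algebraMap k K m * u + 1 = 0) :
    (octic m A).map (algebraMap k K) =
      quarticFactor (algebraMap k K A) u * quarticFactor (algebraMap k K A) u⁻¹ := by
  have h0 : u ≠ 0 := by
    rintro rfl
    simp at hu
  have hinv : u⁻¹ = algebraMap k K m - u := by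
    field_simp
    linear_combination hu
  have hu' : (u⁻¹) ^ 2 - algebraMap k K m * u⁻¹ + 1 = 0 := by
    rw [hinv]
    linear_combination hu
  have hC : C (algebraMap k K m) = (C u + C u⁻¹ : K[X]) := by
    rw [hinv, ← C_add]
    congr 1
    ring
  have hC' : (C u * C u⁻¹ : K[X]) = 1 := by
    rw [← C_mul, mul_inv_cancel₀ h0, C_1]
  have e₀ : (quarticPart₀ m A).map (algebraMap k K) =
      quarticPart₀ (algebraMap k K m) (algebraMap k K A) := by
    simp [quarticPart₀, map_ofNat (algebraMap k K)]
  have e₁ : (quarticPart₁ m A).map (algebraMap k K) =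
      quarticPart₁ (algebraMap k K m) (algebraMap k K A) := by
    simp [quarticPart₁, map_ofNat (algebraMap k K)]
  rw [quarticFactor_eq _ _ _ hu, quarticFactor_eq _ _ _ hu']
  simp only [octic, Polynomial.map_add, Polynomial.map_mul, Polynomial.map_pow, map_C, e₀, e₁]
  rw [hC]
  linear_combination (-(quarticPart₁ (algebraMap k K m) (algebraMap k K A)) ^ 2) * hC'

/-- The splitting field of `T(m, A, x)` over `k` inside an extension field `Ω` (meant for
`Ω` algebraically closed): the field generated over `k` by the zeroes of the octic in `Ω`. -/
noncomputable abbrev octicSplittingField {k : Type*} [Field k] (Ω : Type*) [Field Ω] [Algebra k Ω]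
    (m A : k) : IntermediateField k Ω :=
  IntermediateField.adjoin k ((octic m A).rootSet Ω)

/-- The permutation `(0 1 2 3)(4 5 6 7)`. -/
def perm8a : Equiv.Perm (Fin 8) := c[0, 1, 2, 3] * c[4, 5, 6, 7]

/-- The permutation `(4 6)(5 7)`. -/
def perm8b : Equiv.Perm (Fin 8) := c[4, 6] * c[5, 7]

/-- The permutation `(0 4)(1 5)(2 6)(3 7)`. -/
def perm8c : Equiv.Perm (Fin 8) := c[0, 4] * c[1, 5] * c[2, 6] * c[3, 7]

/-- The transitive permutation group `8T11` (the almost extraspecial group of order 16, the central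
product of `C₄` and `D₄`), with generators `a`, `b`, `c` satisfying the defining relations
`a⁴ = b² = c² = 1`, `ab = ba`, `ac = ca`, `(bc)² = a²`. -/
def eightT11 : Subgroup (Equiv.Perm (Fin 8)) := Subgroup.closure {perm8a, perm8b, perm8c}

/-- The defining relations of the almost extraspecial group of order 16. -/
theorem eightT11_relations :
    perm8a ^ 4 = 1 ∧ perm8b ^ 2 = 1 ∧ perm8c ^ 2 = 1 ∧
      perm8a * perm8b = perm8b * perm8a ∧ perm8a * perm8c = perm8c * perm8a ∧
      (perm8b * perm8c) ^ 2 = perm8a ^ 2 := by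
  decide +kernel

/-!
The roots of the octic lie in a tower of square roots. Put `u = (m + s) / 2`. The quartic `p` is
stable under `x ↦ u / x`, so it is a product of two quadratics `X ^ 2 - t * X + u`, and
`t = (A - s ± w) / 2`. Let `α(s, w) = t ^ 2 - 4 * u` be the discriminant of such a quadratic. The
crucial identities (`OcticRadicals.disc_mul_disc_neg_w`, `OcticRadicals.disc_mul_disc_neg_s`) are
`α(s, w) * α(s, -w) = ((u - 1) * y) ^ 2` and
`α(s, w) * α(-s, w) = (y * (A + m + 2 + w) / 2) ^ 2`:
over `E = k(s, w, y)` all four discriminants differ by squares, hence one square root `θ` of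
`α(s, w)` generates the splitting field `L` over `E`, and all eight zeroes are explicit in `s`, `w`,
`y`, `θ` (`OcticRadicals.root`).

Since `[E : k] = 8`, all eight sign changes of `s`, `w`, `y` are realized by automorphisms of any
Galois extension containing `E` (`exists_algEquiv_signCharacter`). A lift `g` of `w ↦ -w`, `y ↦ -y`
satisfies `g θ * θ = ± (u - 1) * y`, and applying `g` once more gives `g (g θ) = -θ`
(`OcticRadicals.exists_algEquiv_neg_θ`). So `θ` is not in `E`, all sixteen combinations of signs
occur, and there are no other automorphisms. Automorphisms that permute the numbered zeroes by the
three generators of `8T11` are then written down, and `Gal(L/k)` is `8T11` because both groups have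
order 16. It acts transitively on the zeroes, whence the irreducibility.

For the subgroups, `8T11` is identified with the Pauli group `⟨i, X, Z⟩`, whose multiplication is
explicit. Its subgroups of index two are the kernels of its seven nontrivial characters to `±1`; the
number of solutions of `g ^ 2 = 1` in such a kernel tells `Q₈`, `D₄` and `C₄ × C₂` apart. On the
field side the character that belongs to `k(d)`, for `d` a product of some of `s`, `w`, `y`, is read
off from the signs that the three generators put on `d`
(`OcticRadicals.map_fixingSubgroup`, `OcticRadicals.map_eq_ker_iff`).
-/

/-! ### The Pauli group and its subgroups of index two -/

/-- The Pauli group `⟨i, X, Z⟩`, of order 16: the triple `(k, a, b)` stands for `i ^ k * X ^ a * Z ^ b`,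
where `i` is central of order four and `X`, `Z` are involutions with `Z * X = i ^ 2 * X * Z`. -/
@[ext]
structure PauliGroup where
  /-- The exponent of the central element `i`. -/
  k : ZMod 4
  /-- The exponent of the involution `X`. -/
  a : ZMod 2
  /-- The exponent of the involution `Z`. -/
  b : ZMod 2
deriving DecidableEq, Fintype

namespace PauliGroup

instance : Mul PauliGroup :=
  ⟨fun x y => ⟨x.k + y.k + if x.b = 1 ∧ y.a = 1 then 2 else 0, x.a + y.a, x.b + y.b⟩⟩

instance : One PauliGroup := ⟨⟨0, 0, 0⟩⟩

instance : Inv PauliGroup :=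
  ⟨fun x => ⟨-x.k + if x.b = 1 ∧ x.a = 1 then 2 else 0, x.a, x.b⟩⟩

instance : Group PauliGroup :=
  Group.ofLeftAxioms (by decide +kernel) (by decide +kernel) (by decide +kernel)

/-- The central element `i` of order four. -/
def i : PauliGroup := ⟨1, 0, 0⟩

/-- The involution `X`. -/
def x : PauliGroup := ⟨0, 1, 0⟩

/-- The involution `Z`. -/
def z : PauliGroup := ⟨0, 0, 1⟩

theorem eq_prod : ∀ g : PauliGroup, g = i ^ g.k.val * x ^ g.a.val * z ^ g.b.val := by
  decide +kernel

/-- The character with values `p`, `q`, `r` at `i`, `X`, `Z`. -/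
def character (p q r : ℤˣ) : PauliGroup →* ℤˣ where
  toFun g := p ^ g.k.val * q ^ g.a.val * r ^ g.b.val
  map_one' := by simp [show (1 : PauliGroup) = ⟨0, 0, 0⟩ from rfl]
  map_mul' := by revert p q r; decide +kernel

/-- A character is determined by its values at the generators. -/
theorem eq_character (f : PauliGroup →* ℤˣ) : f = character (f i) (f x) (f z) := by
  ext g
  conv_lhs => rw [eq_prod g]
  simp [character]

theorem card_eq : Nat.card PauliGroup = 16 := by
  rw [Nat.card_eq_fintype_card]
  decide +kernel

/-- Every subgroup of index two is the kernel of a nontrivial character. -/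
theorem exists_eq_ker_of_index_eq_two {H : Subgroup PauliGroup} (hH : H.index = 2) :
    ∃ p q r : ℤˣ, (p, q, r) ≠ 1 ∧ H = (character p q r).ker := by
  classical
  let f : PauliGroup →* ℤˣ :=
    { toFun g := if g ∈ H then 1 else -1
      map_one' := by simp [H.one_mem]
      map_mul' g h := by
        have := Subgroup.mul_mem_iff_of_index_two hH (a := g) (b := h)
        by_cases hg : g ∈ H <;> by_cases hh : h ∈ H <;> simp_all }
  have hf : H = f.ker := by
    ext g
    by_cases hg : g ∈ H <;> simp [f, MonoidHom.mem_ker, hg]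
  refine ⟨f i, f x, f z, fun h => ?_, by rw [← eq_character, hf]⟩
  have h1 : f = 1 := by
    rw [eq_character f]
    simp only [Prod.ext_iff, Prod.fst_one, Prod.snd_one] at h
    ext g
    simp [character, h.1, h.2.1, h.2.2]
  rw [hf, h1, MonoidHom.ker_one, Subgroup.index_top] at hH
  omega

instance (p q r : ℤˣ) : DecidablePred (· ∈ (character p q r).ker) :=
  fun _ => decidable_of_iff _ MonoidHom.mem_ker.symm

/-- The number of solutions of `g ^ 2 = 1` in the kernels of the nontrivial characters. -/
theorem card_sq_eq_one_ker : ∀ p q r : ℤˣ, (p, q, r) ≠ 1 →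
    Fintype.card {g : (character p q r).ker // g ^ 2 = 1} =
      if p = 1 then 4 else if (p, q, r) = -1 then 2 else 6 := by
  decide +kernel

theorem card_ker {p q r : ℤˣ} (h : (p, q, r) ≠ 1) : Nat.card (character p q r).ker = 8 := by
  rw [Nat.card_eq_fintype_card]
  revert p q r
  decide +kernel

theorem eq_of_ker_character_eq {p q r p' q' r' : ℤˣ}
    (h : (character p q r).ker = (character p' q' r').ker) : (p, q, r) = (p', q', r') := by
  have h' (g : PauliGroup) : character p q r g = 1 ↔ character p' q' r' g = 1 := by
    rw [← MonoidHom.mem_ker, h, MonoidHom.mem_ker]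
  have hi := h' i
  have hx := h' x
  have hz := h' z
  clear h h'
  revert p q r p' q' r'
  decide +kernel

/-- A subgroup isomorphic to a group `Q` of order eight has index two, so it is the kernel of a
character, and the number of square roots of `1` in `Q` restricts which one. -/
theorem exists_eq_ker_of_mulEquiv {Q : Type*} [Group Q] [Fintype Q] [DecidableEq Q]
    (hQ : Fintype.card Q = 8) {H : Subgroup PauliGroup} (e : H ≃* Q) :
    ∃ p q r : ℤˣ, (p, q, r) ≠ 1 ∧ H = (character p q r).ker ∧
      Fintype.card {g : Q // g ^ 2 = 1} =
        if p = 1 then 4 else if (p, q, r) = -1 then 2 else 6 := by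
  have hcard : Nat.card H = 8 := by rw [Nat.card_congr e.toEquiv, Nat.card_eq_fintype_card, hQ]
  have hi : H.index = 2 := by
    have := H.card_mul_index
    rw [hcard, card_eq] at this
    omega
  obtain ⟨p, q, r, h, rfl⟩ := exists_eq_ker_of_index_eq_two hi
  refine ⟨p, q, r, h, rfl, ?_⟩
  rw [← card_sq_eq_one_ker p q r h]
  refine Fintype.card_congr (e.symm.toEquiv.subtypeEquiv fun g => ?_)
  rw [MulEquiv.toEquiv_eq_coe, EquivLike.coe_coe, ← map_pow, map_eq_one_iff _ e.symm.injective]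

/-- An injective homomorphism from a group of order eight into the kernel of a nontrivial character
is onto that kernel, which also has order eight. -/
theorem nonempty_ker_mulEquiv {Q : Type*} [Group Q] [Fintype Q] (hQ : Fintype.card Q = 8)
    {p q r : ℤˣ} (h : (p, q, r) ≠ 1) (f : Q →* PauliGroup) (hf : Function.Injective f)
    (hfk : ∀ g, character p q r (f g) = 1) : Nonempty ((character p q r).ker ≃* Q) := by
  have : f.range = (character p q r).ker := by
    refine Subgroup.eq_of_le_of_card_ge ?_ ?_
    · rintro _ ⟨g, rfl⟩
      exact hfk g
    · rw [card_ker h, ← Nat.card_congr (MonoidHom.ofInjective hf).toEquiv,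
        Nat.card_eq_fintype_card, hQ]
  exact ⟨((MonoidHom.ofInjective hf).trans (MulEquiv.subgroupCongr this)).symm⟩

/-- The homomorphism from the quaternion group with values `u`, `v` at the generators `a 1`, `xa 0`. -/
def ofQuaternion (u v : PauliGroup) (h : u ^ 4 = 1 ∧ v ^ 2 = u ^ 2 ∧ u * v = v * u⁻¹) :
    QuaternionGroup 2 →* PauliGroup where
  toFun
    | .a j => u ^ j.val
    | .xa j => v * u ^ j.val
  map_one' := pow_zero u
  map_mul' := by revert u v; decide +kernel

/-- The homomorphism from the dihedral group with values `u`, `v` at the generators `r 1`, `sr 0`. -/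
def ofDihedral (u v : PauliGroup) (h : u ^ 4 = 1 ∧ v ^ 2 = 1 ∧ u * v = v * u⁻¹) :
    DihedralGroup 4 →* PauliGroup where
  toFun
    | .r j => u ^ j.val
    | .sr j => v * u ^ j.val
  map_one' := pow_zero u
  map_mul' := by revert u v; decide +kernel

/-- The homomorphism from `C₄ × C₂` with values `u`, `v` at the generators. -/
def ofFourTwo (u v : PauliGroup) (h : u ^ 4 = 1 ∧ v ^ 2 = 1 ∧ u * v = v * u) :
    Multiplicative (ZMod 4) × Multiplicative (ZMod 2) →* PauliGroup where
  toFun g := u ^ g.1.toAdd.val * v ^ g.2.toAdd.val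
  map_one' := by simp
  map_mul' := by revert u v; decide +kernel

theorem nonempty_mulEquiv_quaternion_iff (H : Subgroup PauliGroup) :
    Nonempty (H ≃* QuaternionGroup 2) ↔ H = (character (-1) (-1) (-1)).ker := by
  constructor
  · rintro ⟨e⟩
    obtain ⟨p, q, r, h, rfl, hc⟩ := exists_eq_ker_of_mulEquiv (by decide) e
    rw [show Fintype.card {g : QuaternionGroup 2 // g ^ 2 = 1} = 2 by decide +kernel] at hc
    rcases Int.units_eq_one_or p with rfl | rfl <;> rcases Int.units_eq_one_or q with rfl | rfl <;>
      rcases Int.units_eq_one_or r with rfl | rfl <;>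
      first | exact absurd rfl h | exact absurd hc (by decide) | simp
  · rintro rfl
    exact nonempty_ker_mulEquiv (by decide) (by decide)
      (ofQuaternion (i * x) (i * z) (by decide +kernel)) (by decide +kernel) (by decide +kernel)

theorem nonempty_mulEquiv_dihedral_iff (H : Subgroup PauliGroup) :
    Nonempty (H ≃* DihedralGroup 4) ↔
      H = (character (-1) 1 1).ker ∨ H = (character (-1) (-1) 1).ker ∨
        H = (character (-1) 1 (-1)).ker := by
  constructor
  · rintro ⟨e⟩
    obtain ⟨p, q, r, h, rfl, hc⟩ := exists_eq_ker_of_mulEquiv (by decide) e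
    rw [show Fintype.card {g : DihedralGroup 4 // g ^ 2 = 1} = 6 by decide +kernel] at hc
    rcases Int.units_eq_one_or p with rfl | rfl <;> rcases Int.units_eq_one_or q with rfl | rfl <;>
      rcases Int.units_eq_one_or r with rfl | rfl <;>
      first | exact absurd rfl h | exact absurd hc (by decide) | simp
  · rintro (rfl | rfl | rfl)
    · exact nonempty_ker_mulEquiv (by decide) (by decide)
        (ofDihedral (x * z) x (by decide +kernel)) (by decide +kernel) (by decide +kernel)
    · exact nonempty_ker_mulEquiv (by decide) (by decide)
        (ofDihedral (i * x) z (by decide +kernel)) (by decide +kernel) (by decide +kernel)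
    · exact nonempty_ker_mulEquiv (by decide) (by decide)
        (ofDihedral (i * z) x (by decide +kernel)) (by decide +kernel) (by decide +kernel)

theorem nonempty_mulEquiv_four_two_iff (H : Subgroup PauliGroup) :
    Nonempty (H ≃* Multiplicative (ZMod 4) × Multiplicative (ZMod 2)) ↔
      H = (character 1 (-1) 1).ker ∨ H = (character 1 1 (-1)).ker ∨
        H = (character 1 (-1) (-1)).ker := by
  constructor
  · rintro ⟨e⟩
    obtain ⟨p, q, r, h, rfl, hc⟩ := exists_eq_ker_of_mulEquiv (by decide) e
    rw [show Fintype.card {g : Multiplicative (ZMod 4) × Multiplicative (ZMod 2) // g ^ 2 = 1} = 4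
      by decide +kernel] at hc
    rcases Int.units_eq_one_or p with rfl | rfl <;> rcases Int.units_eq_one_or q with rfl | rfl <;>
      rcases Int.units_eq_one_or r with rfl | rfl <;>
      first | exact absurd rfl h | exact absurd hc (by decide) | simp
  · rintro (rfl | rfl | rfl)
    · exact nonempty_ker_mulEquiv (by decide) (by decide)
        (ofFourTwo i z (by decide +kernel)) (by decide +kernel) (by decide +kernel)
    · exact nonempty_ker_mulEquiv (by decide) (by decide)
        (ofFourTwo i x (by decide +kernel)) (by decide +kernel) (by decide +kernel)
    · exact nonempty_ker_mulEquiv (by decide) (by decide)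
        (ofFourTwo i (i * x * z) (by decide +kernel)) (by decide +kernel) (by decide +kernel)

/-! ### The Pauli group as the permutation group `8T11` -/

/-- The action of the Pauli group on eight points: `i`, `X`, `Z` act as `perm8a`, `perm8c`, `perm8b`. -/
def toPerm : PauliGroup →* Equiv.Perm (Fin 8) where
  toFun g := perm8a ^ g.k.val * perm8c ^ g.a.val * perm8b ^ g.b.val
  map_one' := by simp [show (1 : PauliGroup) = ⟨0, 0, 0⟩ from rfl]
  map_mul' := by decide +kernel

theorem toPerm_injective : Function.Injective toPerm := by
  decide +kernel

theorem range_toPerm : toPerm.range = eightT11 := by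
  apply le_antisymm
  · rintro _ ⟨g, rfl⟩
    have ha : perm8a ∈ eightT11 := Subgroup.subset_closure (by simp)
    have hb : perm8b ∈ eightT11 := Subgroup.subset_closure (by simp)
    have hc : perm8c ∈ eightT11 := Subgroup.subset_closure (by simp)
    exact mul_mem (mul_mem (pow_mem ha _) (pow_mem hc _)) (pow_mem hb _)
  · rw [eightT11, Subgroup.closure_le]
    rintro _ (rfl | rfl | rfl)
    · exact ⟨i, by decide +kernel⟩
    · exact ⟨z, by decide +kernel⟩
    · exact ⟨x, by decide +kernel⟩

/-- The Pauli group is isomorphic to `8T11`, with `i`, `X`, `Z` acting as `a`, `c`, `b`. -/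
noncomputable def equivEightT11 : PauliGroup ≃* eightT11 :=
  (MonoidHom.ofInjective toPerm_injective).trans (MulEquiv.subgroupCongr range_toPerm)

theorem card_eightT11 : Nat.card eightT11 = 16 := by
  rw [← Nat.card_congr equivEightT11.toEquiv, card_eq]

/-! ### Transport of subgroups to the Pauli group -/

variable {G : Type*} [Group G]

theorem nonempty_map_mulEquiv_iff (f : G ≃* PauliGroup) (H : Subgroup G) (Q : Type*) [Group Q] :
    Nonempty (H.map f.toMonoidHom ≃* Q) ↔ Nonempty (H ≃* Q) :=
  ⟨fun ⟨e⟩ => ⟨(f.subgroupMap H).trans e⟩, fun ⟨e⟩ => ⟨(f.subgroupMap H).symm.trans e⟩⟩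

theorem ncard_subgroup_mulEquiv (f : G ≃* PauliGroup) (Q : Type*) [Group Q] :
    {H : Subgroup G | Nonempty (H ≃* Q)}.ncard =
      {H : Subgroup PauliGroup | Nonempty (H ≃* Q)}.ncard := by
  refine Set.ncard_congr (fun H _ => f.mapSubgroup H) (fun H h => ?_)
    (fun H K _ _ h => f.mapSubgroup.injective h) (fun K h => ?_)
  · exact (nonempty_map_mulEquiv_iff f H Q).2 h
  · obtain ⟨H, rfl⟩ := f.mapSubgroup.surjective K
    exact ⟨H, (nonempty_map_mulEquiv_iff f H Q).1 h, rfl⟩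

theorem ncard_quaternion :
    {H : Subgroup PauliGroup | Nonempty (H ≃* QuaternionGroup 2)}.ncard = 1 := by
  simp [nonempty_mulEquiv_quaternion_iff]

theorem ncard_eq_three_of_ker {p q r p' q' r' p'' q'' r'' : ℤˣ} (S : Set (Subgroup PauliGroup))
    (hS : ∀ H, H ∈ S ↔ H = (character p q r).ker ∨ H = (character p' q' r').ker ∨
      H = (character p'' q'' r'').ker) (h₁ : (p, q, r) ≠ (p', q', r'))
    (h₂ : (p, q, r) ≠ (p'', q'', r'')) (h₃ : (p', q', r') ≠ (p'', q'', r'')) : S.ncard = 3 :=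
  Set.ncard_eq_three.2 ⟨_, _, _, fun h => h₁ (eq_of_ker_character_eq h),
    fun h => h₂ (eq_of_ker_character_eq h), fun h => h₃ (eq_of_ker_character_eq h),
    Set.ext fun H => by simpa using hS H⟩

theorem ncard_dihedral :
    {H : Subgroup PauliGroup | Nonempty (H ≃* DihedralGroup 4)}.ncard = 3 :=
  ncard_eq_three_of_ker _ nonempty_mulEquiv_dihedral_iff (by decide) (by decide) (by decide)

theorem ncard_four_two :
    {H : Subgroup PauliGroup |
      Nonempty (H ≃* Multiplicative (ZMod 4) × Multiplicative (ZMod 2))}.ncard = 3 :=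
  ncard_eq_three_of_ker _ nonempty_mulEquiv_four_two_iff (by decide) (by decide) (by decide)

end PauliGroup

/-! ### Independent square roots in a Galois extension -/

section SignCharacter

variable {k F : Type*} [Field k] [Field F] [Algebra k F]

theorem algEquiv_apply_eq_or_neg (g : F ≃ₐ[k] F) {d : F} {c : k} (hd : d ^ 2 = algebraMap k F c) :
    g d = d ∨ g d = -d := by
  rw [← sq_eq_sq_iff_eq_or_eq_neg, ← map_pow, hd, AlgEquiv.commutes]

/-- The character of the Galois group attached to a square root `d` of an element of `k`; it is
trivial exactly on the automorphisms that fix `d`. -/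
noncomputable def signCharacter (d : F) {c : k} (hd : d ^ 2 = algebraMap k F c) :
    (F ≃ₐ[k] F) →* ℤˣ := by
  classical
  exact
    { toFun g := if g d = d then 1 else -1
      map_one' := by simp
      map_mul' g h := by
        by_cases h0 : d = -d
        · have h1 (f : F ≃ₐ[k] F) : f d = d := by
            rcases algEquiv_apply_eq_or_neg f hd with h | h
            · exact h
            · rw [h, ← h0]
          simp [h1]
        · have h0' : -d ≠ d := fun h => h0 h.symm
          rcases algEquiv_apply_eq_or_neg g hd with hg | hg <;>
            rcases algEquiv_apply_eq_or_neg h hd with hh | hh <;>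
            simp [AlgEquiv.mul_apply, hg, hh, h0'] }

theorem signCharacter_eq_one_iff {d : F} {c : k} (hd : d ^ 2 = algebraMap k F c) {g : F ≃ₐ[k] F} :
    signCharacter d hd g = 1 ↔ g d = d := by
  by_cases h : g d = d <;> simp [signCharacter, h]

theorem signCharacter_eq_neg_one_iff {d : F} {c : k} (hd : d ^ 2 = algebraMap k F c)
    {g : F ≃ₐ[k] F} : signCharacter d hd g = -1 ↔ g d ≠ d := by
  by_cases h : g d = d <;> simp [signCharacter, h]

theorem apply_eq_signCharacter_mul (g : F ≃ₐ[k] F) {d : F} {c : k}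
    (hd : d ^ 2 = algebraMap k F c) : g d = ((signCharacter d hd g : ℤ) : F) * d := by
  by_cases h : g d = d
  · rw [(signCharacter_eq_one_iff hd).2 h, h]
    simp
  · rw [(signCharacter_eq_neg_one_iff hd).2 h, (algEquiv_apply_eq_or_neg g hd).resolve_left h]
    simp

/-- If three square roots generate a subfield of degree eight, then all eight choices of signs are
realized by automorphisms: the kernel of the three characters has index eight. -/
theorem exists_algEquiv_signCharacter [IsGalois k F] {s w y : F} {c₁ c₂ c₃ : k}
    (hs : s ^ 2 = algebraMap k F c₁) (hw : w ^ 2 = algebraMap k F c₂)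
    (hy : y ^ 2 = algebraMap k F c₃) (hE : Module.finrank k (adjoin k ({s, w, y} : Set F)) = 8)
    (p q r : ℤˣ) : ∃ g : F ≃ₐ[k] F,
      signCharacter s hs g = p ∧ signCharacter w hw g = q ∧ signCharacter y hy g = r := by
  let f := (signCharacter s hs).prod ((signCharacter w hw).prod (signCharacter y hy))
  have hker : f.ker = (adjoin k ({s, w, y} : Set F)).fixingSubgroup := by
    ext g
    rw [MonoidHom.mem_ker, IntermediateField.mem_fixingSubgroup_iff]
    change _ ↔ ∀ x ∈ adjoin k _, g • x = x
    rw [forall_mem_adjoin_smul_eq_self_iff]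
    simp [f, Prod.ext_iff, signCharacter_eq_one_iff]
  have hcard : Nat.card f.range = 8 := by
    rw [← Subgroup.index_ker, hker, ← finrank_eq_fixingSubgroup_index, hE]
  have htop : f.range = ⊤ := by
    refine Subgroup.eq_top_of_card_eq _ ?_
    rw [hcard, Nat.card_eq_fintype_card]
    decide
  obtain ⟨g, hg⟩ := (MonoidHom.range_eq_top.1 htop) (p, q, r)
  simp only [f, MonoidHom.prod_apply, Prod.mk.injEq] at hg
  exact ⟨g, hg⟩

end SignCharacter

/-! ### The roots of the octic in terms of square roots -/

/-- Square roots from which the roots of the octic with parameters `m`, `A` are built: besides `s`,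
`w`, `y` this is a square root `θ` of the discriminant `t ^ 2 - 4 * u` of a quadratic factor
`X ^ 2 - t * X + u` of `p`, where `u = (m + s) / 2` and `t = (A - s + w) / 2`. -/
structure OcticRadicals {K : Type*} [Field K] (m A s w y θ : K) : Prop where
  two_ne : (2 : K) ≠ 0
  m_ne : m ≠ 2
  y_ne : y ≠ 0
  sq_s : s ^ 2 = m ^ 2 - 4
  sq_w : w ^ 2 = (m + 2 + A) ^ 2 - 4 * (m - 2)
  sq_y : y ^ 2 = A ^ 2 - 4 * (m - 2)
  sq_θ : 4 * θ ^ 2 = (A - s + w) ^ 2 - 8 * (m + s)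

/-- The zero `(t + θ) / 2` of `X ^ 2 - t * X + u`, where `t = (A - s + w) / 2`. -/
def radicalRoot {K : Type*} [Field K] (A s w θ : K) : K := (A - s + w) / 4 + θ / 2

theorem mul_radicalRoot_neg {K : Type*} [Field K] (h2 : (2 : K) ≠ 0) {m A s w θ : K}
    (hθ : 4 * θ ^ 2 = (A - s + w) ^ 2 - 8 * (m + s)) :
    (X - C (radicalRoot A s w θ)) * (X - C (radicalRoot A s w (-θ))) =
      X ^ 2 - C ((A - s + w) / 2) * X + C ((m + s) / 2) := by
  have h4 : (4 : K) ≠ 0 := by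
    rw [show (4 : K) = 2 * 2 by norm_num]
    exact mul_ne_zero h2 h2
  have h1 : (A - s + w) / 2 = radicalRoot A s w θ + radicalRoot A s w (-θ) := by
    unfold radicalRoot
    field_simp
    ring
  have h3 : (m + s) / 2 = radicalRoot A s w θ * radicalRoot A s w (-θ) := by
    unfold radicalRoot
    field_simp
    linear_combination 4 * hθ
  rw [h1, h3, C_add, C_mul]
  ring

/-- The quartic `p` is the product of the quadratics `X ^ 2 - t * X + u` for the two values
`t = (A - s ± w) / 2`, with discriminants `θ₁ ^ 2` and `θ₂ ^ 2`. -/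
theorem quarticFactor_eq_mul {K : Type*} [Field K] (h2 : (2 : K) ≠ 0) {m A s w θ₁ θ₂ : K}
    (hs : s ^ 2 = m ^ 2 - 4) (hw : w ^ 2 = (m + 2 + A) ^ 2 - 4 * (m - 2))
    (hθ₁ : 4 * θ₁ ^ 2 = (A - s + w) ^ 2 - 8 * (m + s))
    (hθ₂ : 4 * θ₂ ^ 2 = (A - s - w) ^ 2 - 8 * (m + s)) :
    quarticFactor A ((m + s) / 2) =
      ((X - C (radicalRoot A s w θ₁)) * (X - C (radicalRoot A s w (-θ₁)))) *
        ((X - C (radicalRoot A s (-w) θ₂)) * (X - C (radicalRoot A s (-w) (-θ₂)))) := by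
  rw [mul_radicalRoot_neg h2 hθ₁, mul_radicalRoot_neg (m := m) h2 (by rw [hθ₂]; ring)]
  have hinv : ((m + s) / 2)⁻¹ = (m - s) / 2 := by
    apply inv_eq_of_mul_eq_one_right
    field_simp
    linear_combination -hs
  have e₁ : (m + s) / 2 - (m - s) / 2 - A = -((A - s + w) / 2 + (A - s + -w) / 2) := by
    field_simp
    ring
  have e₂ : (2 - A) * ((m + s) / 2) - A - 4 =
      (A - s + w) / 2 * ((A - s + -w) / 2) + 2 * ((m + s) / 2) := by
    field_simp
    linear_combination -hs + hw
  have e₃ : ((m + s) / 2) ^ 2 - 1 - A * ((m + s) / 2) =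
      -((A - s + w) / 2 + (A - s + -w) / 2) * ((m + s) / 2) := by
    field_simp
    linear_combination -hs
  rw [quarticFactor, hinv, e₁, e₂, e₃]
  simp only [map_add, map_mul, map_neg, map_pow, map_ofNat]
  ring

namespace OcticRadicals

variable {K : Type*} [Field K] {m A s w y θ : K}

section
variable (h : OcticRadicals m A s w y θ)
include h

theorem four_ne : (4 : K) ≠ 0 := by
  rw [show (4 : K) = 2 * 2 by norm_num]
  exact mul_ne_zero h.two_ne h.two_ne

/-- The product of `m + s - 2` and `m - s - 2` is `-4 * (m - 2)`. -/
theorem add_s_ne : m + s - 2 ≠ 0 := by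
  intro h0
  refine mul_ne_zero h.four_ne (sub_ne_zero.2 h.m_ne) ?_
  linear_combination -h.sq_s + (s - m + 2) * h0

theorem sub_s_ne : m - s - 2 ≠ 0 := by
  intro h0
  refine mul_ne_zero h.four_ne (sub_ne_zero.2 h.m_ne) ?_
  linear_combination -h.sq_s - (s + m - 2) * h0

/-- The product of `A + m + 2 + w` and `A + m + 2 - w` is `4 * (m - 2)`. -/
theorem add_w_ne : A + m + 2 + w ≠ 0 := by
  intro h0
  refine mul_ne_zero h.four_ne (sub_ne_zero.2 h.m_ne) ?_
  linear_combination h.sq_w + (A + m + 2 - w) * h0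

theorem sub_w_ne : A + m + 2 - w ≠ 0 := by
  intro h0
  refine mul_ne_zero h.four_ne (sub_ne_zero.2 h.m_ne) ?_
  linear_combination h.sq_w + (A + m + 2 + w) * h0

/-- The product of the discriminants `t ^ 2 - 4 * u` for `w` and `-w`, each multiplied by `4`, is a
square in `k(s, y)`. -/
theorem disc_mul_disc_neg_w :
    ((A - s + w) ^ 2 - 8 * (m + s)) * ((A - s - w) ^ 2 - 8 * (m + s)) =
      4 * ((m + s - 2) * y) ^ 2 := by
  linear_combination
    (-A ^ 2 + 4 * A * s - 2 * s ^ 2 + w ^ 2 - 16 * m - 16 * s + m ^ 2 + 2 * m * A + 12 + 4 * A) * h.sq_w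
      - 4 * (m + s - 2) ^ 2 * h.sq_y
      + (-4 * A * s + 24 * A + s ^ 2 - 16 * s + 4 - m ^ 2 - 4 * m * A) * h.sq_s

/-- The product of the discriminants `t ^ 2 - 4 * u` for `s` and `-s`, each multiplied by `4`, is a
square in `k(w, y)`. -/
theorem disc_mul_disc_neg_s :
    ((A - s + w) ^ 2 - 8 * (m + s)) * ((A + s + w) ^ 2 - 8 * (m - s)) =
      4 * ((A + m + 2 + w) * y) ^ 2 := by
  linear_combination
    (7 * A ^ 2 + 4 * A * w - 2 * s ^ 2 + w ^ 2 - 16 * m - 4 * y ^ 2 + m ^ 2 + 2 * m * A + 12 + 4 * A)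
        * h.sq_w
      - 8 * (A ^ 2 + 2 * m * A + 4 * A + A * w + m ^ 2 + 2 * m + m * w + 8 + 2 * w) * h.sq_y
      + (-4 * A ^ 2 - 4 * A * w - 40 * A + s ^ 2 - 16 * m - 32 * w - 92 - m ^ 2 - 4 * m * A) * h.sq_s

theorem θ_ne : θ ≠ 0 := by
  rintro rfl
  have h1 := h.disc_mul_disc_neg_w
  rw [← h.sq_θ] at h1
  refine mul_ne_zero h.four_ne (pow_ne_zero 2 (mul_ne_zero h.add_s_ne h.y_ne)) ?_
  rw [← h1]
  ring

theorem neg_y : OcticRadicals m A s w (-y) θ :=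
  { h with
    y_ne := neg_ne_zero.2 h.y_ne
    sq_y := by rw [neg_sq, h.sq_y] }

theorem neg_w : OcticRadicals m A s (-w) y ((m + s - 2) * y / (2 * θ)) :=
  { h with
    sq_w := by rw [neg_sq, h.sq_w]
    sq_θ := by
      have h1 := h.disc_mul_disc_neg_w
      have h2 := h.two_ne
      have h3 := h.θ_ne
      rw [← h.sq_θ] at h1
      field_simp
      refine mul_left_cancel₀ h.four_ne ?_
      linear_combination -4 * h1 }

theorem neg_s : OcticRadicals m A (-s) w y ((A + m + 2 + w) * y / (2 * θ)) :=
  { h with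
    sq_s := by rw [neg_sq, h.sq_s]
    sq_θ := by
      have h1 := h.disc_mul_disc_neg_s
      have h2 := h.two_ne
      have h3 := h.θ_ne
      rw [← h.sq_θ] at h1
      field_simp
      refine mul_left_cancel₀ h.four_ne ?_
      linear_combination -4 * h1 }

/-- The composite of `neg_s`, `neg_w` and `neg_y`; the value at `θ` simplifies, so that `y` drops
out of it. -/
theorem neg_s_w_y :
    OcticRadicals m A (-s) (-w) (-y) ((m - s - 2) * θ / (A + m + 2 + w)) := by
  have h1 := h.neg_s.neg_w.neg_y
  have h2 := h.two_ne
  have h3 := h.θ_ne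
  have h4 := h.y_ne
  have h5 := h.add_w_ne
  convert h1 using 1
  field_simp
  ring

end

/-- The zeroes of the octic, numbered so that `perm8a`, `perm8b` and `perm8c` come from
automorphisms that change the signs of `s`, `w`, `y`, of `y` alone, and of `w` alone. -/
def root (m A s w y θ : K) : Fin 8 → K :=
  ![radicalRoot A s w θ,
    radicalRoot A (-s) (-w) ((m - s - 2) * θ / (A + m + 2 + w)),
    radicalRoot A s w (-θ),
    radicalRoot A (-s) (-w) (-((m - s - 2) * θ / (A + m + 2 + w))),
    radicalRoot A s (-w) ((m + s - 2) * y / (2 * θ)),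
    radicalRoot A (-s) w (-((A + m + 2 + w) * y / (2 * θ))),
    radicalRoot A s (-w) (-((m + s - 2) * y / (2 * θ))),
    radicalRoot A (-s) w ((A + m + 2 + w) * y / (2 * θ))]

theorem octic_map_eq_prod {k : Type*} [Field k] [Algebra k K] {m A : k}
    (h : OcticRadicals (algebraMap k K m) (algebraMap k K A) s w y θ) :
    (octic m A).map (algebraMap k K) =
      ∏ i, (X - C (root (algebraMap k K m) (algebraMap k K A) s w y θ i)) := by
  have h2 := h.two_ne
  have h4 := h.four_ne
  have hinv : ((algebraMap k K m + s) / 2)⁻¹ = (algebraMap k K m + -s) / 2 := by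
    apply inv_eq_of_mul_eq_one_right
    field_simp
    linear_combination -h.sq_s
  rw [octic_map m A ((algebraMap k K m + s) / 2), hinv,
    quarticFactor_eq_mul h2 h.sq_s h.sq_w h.sq_θ (θ₂ := _) (by
      have := h.neg_w.sq_θ
      rwa [← sub_eq_add_neg] at this),
    quarticFactor_eq_mul h2 h.neg_s.sq_s h.neg_s.sq_w h.neg_s.sq_θ (θ₂ := _) (by
      have := h.neg_s_w_y.sq_θ
      rwa [← sub_eq_add_neg] at this)]
  · simp only [Fin.prod_univ_eight, root, Fin.isValue, Matrix.cons_val]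
    ring
  · field_simp
    linear_combination h.sq_s

end OcticRadicals

/-! ### The Galois group of the octic -/

theorem cons_apply_perm8a {α : Type*} (x₀ x₁ x₂ x₃ x₄ x₅ x₆ x₇ : α) (i : Fin 8) :
    ![x₁, x₂, x₃, x₀, x₅, x₆, x₇, x₄] i =
      ![x₀, x₁, x₂, x₃, x₄, x₅, x₆, x₇] (perm8a i) := by
  rw [show ⇑perm8a = ![1, 2, 3, 0, 5, 6, 7, 4] by decide +kernel]
  fin_cases i <;> simp

theorem cons_apply_perm8b {α : Type*} (x₀ x₁ x₂ x₃ x₄ x₅ x₆ x₇ : α) (i : Fin 8) :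
    ![x₀, x₁, x₂, x₃, x₆, x₇, x₄, x₅] i =
      ![x₀, x₁, x₂, x₃, x₄, x₅, x₆, x₇] (perm8b i) := by
  rw [show ⇑perm8b = ![0, 1, 2, 3, 6, 7, 4, 5] by decide +kernel]
  fin_cases i <;> simp

theorem cons_apply_perm8c {α : Type*} (x₀ x₁ x₂ x₃ x₄ x₅ x₆ x₇ : α) (i : Fin 8) :
    ![x₄, x₅, x₆, x₇, x₀, x₁, x₂, x₃] i =
      ![x₀, x₁, x₂, x₃, x₄, x₅, x₆, x₇] (perm8c i) := by
  rw [show ⇑perm8c = ![4, 5, 6, 7, 0, 1, 2, 3] by decide +kernel]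
  fin_cases i <;> simp

section

variable {k F : Type*} [Field k] [Field F] [Algebra k F] {m A : k} {s w y : F}

theorem two_ne_zero_of_finrank (hs : s ^ 2 = algebraMap k F (m ^ 2 - 4))
    (hw : w ^ 2 = algebraMap k F ((m + 2 + A) ^ 2 - 4 * (m - 2)))
    (hy : y ^ 2 = algebraMap k F (A ^ 2 - 4 * (m - 2)))
    (hE : Module.finrank k (adjoin k ({s, w, y} : Set F)) = 8) : (2 : k) ≠ 0 := by
  intro h2
  have h4 : (4 : k) = 0 := by linear_combination (2 : k) * h2
  -- In characteristic two the three radicands are squares in `k`.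
  have key {d : F} {c : k} (hd : d ^ 2 = algebraMap k F (c ^ 2)) :
      d ∈ (⊥ : IntermediateField k F) := by
    rw [map_pow, sq_eq_sq_iff_eq_or_eq_neg] at hd
    rcases hd with rfl | rfl
    · exact IntermediateField.algebraMap_mem _ _
    · exact neg_mem (IntermediateField.algebraMap_mem _ _)
  have hbot : adjoin k ({s, w, y} : Set F) = ⊥ := by
    rw [eq_bot_iff, adjoin_le_iff]
    rintro d (rfl | rfl | rfl)
    · exact key (c := m) (by rw [hs, h4, sub_zero])
    · exact key (c := m + 2 + A) (by rw [hw, h4, zero_mul, sub_zero])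
    · exact key (c := A) (by rw [hy, h4, zero_mul, sub_zero])
  rw [hbot, IntermediateField.finrank_bot] at hE
  omega

/-- An automorphism that changes the signs of `s`, `w`, `y` as prescribed. -/
theorem exists_algEquiv_mul [IsGalois k F] (hs : s ^ 2 = algebraMap k F (m ^ 2 - 4))
    (hw : w ^ 2 = algebraMap k F ((m + 2 + A) ^ 2 - 4 * (m - 2)))
    (hy : y ^ 2 = algebraMap k F (A ^ 2 - 4 * (m - 2)))
    (hE : Module.finrank k (adjoin k ({s, w, y} : Set F)) = 8) (p q r : ℤˣ) :
    ∃ g : F ≃ₐ[k] F, g s = ((p : ℤ) : F) * s ∧ g w = ((q : ℤ) : F) * w ∧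
      g y = ((r : ℤ) : F) * y := by
  obtain ⟨g, h₁, h₂, h₃⟩ := exists_algEquiv_signCharacter hs hw hy hE p q r
  exact ⟨g, h₁ ▸ apply_eq_signCharacter_mul g hs, h₂ ▸ apply_eq_signCharacter_mul g hw,
    h₃ ▸ apply_eq_signCharacter_mul g hy⟩

/-- If `m = 2`, then `s = 0`; but each of `s`, `y` is moved by some automorphism. -/
theorem m_ne_two_and_y_ne_zero [IsGalois k F] (hs : s ^ 2 = algebraMap k F (m ^ 2 - 4))
    (hw : w ^ 2 = algebraMap k F ((m + 2 + A) ^ 2 - 4 * (m - 2)))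
    (hy : y ^ 2 = algebraMap k F (A ^ 2 - 4 * (m - 2)))
    (hE : Module.finrank k (adjoin k ({s, w, y} : Set F)) = 8) : m ≠ 2 ∧ y ≠ 0 := by
  obtain ⟨g, h₁, h₂, h₃⟩ := exists_algEquiv_signCharacter hs hw hy hE (-1) (-1) (-1)
  rw [signCharacter_eq_neg_one_iff] at h₁ h₃
  refine ⟨?_, ?_⟩
  · rintro rfl
    have : s = 0 := by
      rw [← sq_eq_zero_iff, hs, ← map_zero (algebraMap k F)]
      congr 1
      ring
    exact h₁ (by rw [this, map_zero])
  · rintro rfl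
    exact h₃ (map_zero g)

end

namespace OcticRadicals

section

variable {k L : Type*} [Field k] [Field L] [Algebra k L] {m A : k} {s w y θ : L}

theorem map (h : OcticRadicals (algebraMap k L m) (algebraMap k L A) s w y θ) (g : L ≃ₐ[k] L) :
    OcticRadicals (algebraMap k L m) (algebraMap k L A) (g s) (g w) (g y) (g θ) where
  two_ne := h.two_ne
  m_ne := h.m_ne
  y_ne := by simpa using h.y_ne
  sq_s := by simpa [map_ofNat g] using congrArg g h.sq_s
  sq_w := by simpa [map_ofNat g] using congrArg g h.sq_w
  sq_y := by simpa [map_ofNat g] using congrArg g h.sq_y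
  sq_θ := by simpa [map_ofNat g] using congrArg g h.sq_θ

/-- Up to sign, `θ` depends only on `s` and `w`. -/
theorem θ_eq_or_neg {K : Type*} [Field K] {m A s w y y' θ θ' : K} (h : OcticRadicals m A s w y θ)
    (h' : OcticRadicals m A s w y' θ') : θ = θ' ∨ θ = -θ' := by
  rw [← sq_eq_sq_iff_eq_or_eq_neg]
  exact mul_left_cancel₀ h.four_ne (h.sq_θ.trans h'.sq_θ.symm)

variable (h : OcticRadicals (algebraMap k L m) (algebraMap k L A) s w y θ)
include h

theorem sq_s' : s ^ 2 = algebraMap k L (m ^ 2 - 4) := by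
  simpa [map_ofNat (algebraMap k L)] using h.sq_s

theorem sq_w' : w ^ 2 = algebraMap k L ((m + 2 + A) ^ 2 - 4 * (m - 2)) := by
  simpa [map_ofNat (algebraMap k L)] using h.sq_w

theorem sq_y' : y ^ 2 = algebraMap k L (A ^ 2 - 4 * (m - 2)) := by
  simpa [map_ofNat (algebraMap k L)] using h.sq_y

variable [IsGalois k L] (hE : Module.finrank k (adjoin k ({s, w, y} : Set L)) = 8)
include hE

/-- The square of a lift of `w ↦ -w`, `y ↦ -y` changes the sign of `θ`, because this lift changes
the sign of the product `(u - 1) * y` of `θ` and its image. In particular `θ` does not lie in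
`k(s, w, y)`. -/
theorem exists_algEquiv_neg_θ : ∃ g : L ≃ₐ[k] L, g s = s ∧ g w = w ∧ g y = y ∧ g θ = -θ := by
  obtain ⟨g, hgs, hgw, hgy⟩ := exists_algEquiv_mul h.sq_s' h.sq_w' h.sq_y' hE 1 (-1) (-1)
  simp only [Units.val_one, Int.cast_one, one_mul, Units.val_neg, Int.cast_neg, neg_mul]
    at hgs hgw hgy
  have h2 := h.two_ne
  have hθ := h.θ_ne
  have hgθ : g θ = (algebraMap k L m + s - 2) * y / (2 * θ) ∨
      g θ = -((algebraMap k L m + s - 2) * y / (2 * θ)) := by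
    have := h.map g
    rw [hgs, hgw] at this
    exact this.θ_eq_or_neg h.neg_w
  have hne : g θ ≠ 0 := by simpa using hθ
  have hm : g θ * θ = (algebraMap k L m + s - 2) * y / 2 ∨
      g θ * θ = -((algebraMap k L m + s - 2) * y / 2) := by
    rcases hgθ with e | e
    · left
      rw [e]
      field_simp
    · right
      rw [e]
      field_simp
  refine ⟨g * g, by simp [hgs], by simp [hgw], by simp [hgy], ?_⟩
  rw [AlgEquiv.mul_apply]
  refine mul_right_cancel₀ hne ?_
  rcases hm with e | e
  · have := congrArg g e
    simp only [map_mul, map_div₀, map_sub, map_add, AlgEquiv.commutes, hgs, hgy, map_ofNat] at this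
    rw [this]
    linear_combination e
  · have := congrArg g e
    simp only [map_mul, map_div₀, map_sub, map_add, AlgEquiv.commutes, hgs, hgy, map_ofNat,
      map_neg] at this
    rw [this]
    linear_combination e

/-- Every compatible choice of signs for `s`, `w`, `y`, `θ` is realized by an automorphism. -/
theorem exists_algEquiv {p q r : ℤˣ} {θ' : L}
    (h' : OcticRadicals (algebraMap k L m) (algebraMap k L A) (((p : ℤ) : L) * s)
      (((q : ℤ) : L) * w) (((r : ℤ) : L) * y) θ') :
    ∃ g : L ≃ₐ[k] L, g s = ((p : ℤ) : L) * s ∧ g w = ((q : ℤ) : L) * w ∧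
      g y = ((r : ℤ) : L) * y ∧ g θ = θ' := by
  obtain ⟨g, hgs, hgw, hgy⟩ := exists_algEquiv_mul h.sq_s' h.sq_w' h.sq_y' hE p q r
  have hg := h.map g
  rw [hgs, hgw] at hg
  rcases hg.θ_eq_or_neg h' with e | e
  · exact ⟨g, hgs, hgw, hgy, e⟩
  · obtain ⟨z, hzs, hzw, hzy, hzθ⟩ := h.exists_algEquiv_neg_θ hE
    exact ⟨g * z, by simp [hzs, hgs], by simp [hzw, hgw], by simp [hzy, hgy], by simp [hzθ, e]⟩

theorem ne_zero_and_ne : s ≠ 0 ∧ w ≠ 0 ∧ s ≠ w ∧ s ≠ -w := by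
  obtain ⟨f, hfs, hfw, -⟩ := exists_algEquiv_signCharacter h.sq_s' h.sq_w' h.sq_y' hE (-1) 1 1
  obtain ⟨f', hfs', hfw', -⟩ :=
    exists_algEquiv_signCharacter h.sq_s' h.sq_w' h.sq_y' hE 1 (-1) 1
  rw [signCharacter_eq_neg_one_iff] at hfs hfw'
  rw [signCharacter_eq_one_iff] at hfw hfs'
  refine ⟨?_, ?_, ?_, ?_⟩
  · rintro rfl
    exact hfs (map_zero f)
  · rintro rfl
    exact hfw' (map_zero f')
  · rintro rfl
    exact hfs hfw
  · rintro rfl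
    exact hfs (by rw [map_neg, hfw])

theorem root_injective :
    Function.Injective (root (algebraMap k L m) (algebraMap k L A) s w y θ) := by
  have h2 := h.two_ne
  have h4 := h.four_ne
  have ne_neg {d : L} (hd : d ≠ 0) : d ≠ -d := fun e =>
    mul_ne_zero h2 hd (by linear_combination e)
  obtain ⟨hs, hw, hsw, hsw'⟩ := h.ne_zero_and_ne hE
  -- An automorphism that fixes `s`, `w`, `y` and changes the sign of `θ` separates each zero into
  -- its component in `k(s, w)` and its component in `k(s, w, y) * θ`. The former
  -- determines the signs of `s` and `w`, and the latter is nonzero, so its sign is determined as well.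
  obtain ⟨g, hgs, hgw, hgy, hgθ⟩ := h.exists_algEquiv_neg_θ hE
  set θ₂ := (algebraMap k L m + s - 2) * y / (2 * θ) with hθ₂
  set θ₃ := (algebraMap k L A + algebraMap k L m + 2 + w) * y / (2 * θ) with hθ₃
  set θ₄ := (algebraMap k L m - s - 2) * θ / (algebraMap k L A + algebraMap k L m + 2 + w) with hθ₄
  have hg₂ : g θ₂ = -θ₂ := by
    simp [hθ₂, hgs, hgy, hgθ, map_ofNat g, div_neg]
  have hg₃ : g θ₃ = -θ₃ := by
    simp [hθ₃, hgw, hgy, hgθ, map_ofNat g, div_neg]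
  have hg₄ : g θ₄ = -θ₄ := by
    simp [hθ₄, hgs, hgw, hgθ, map_ofNat g, neg_div]
  let T : Fin 8 → L := ![-s + w, s - w, -s + w, s - w, -s - w, s + w, -s - w, s + w]
  let Θ : Fin 8 → L := ![θ, θ₄, -θ, -θ₄, θ₂, -θ₃, -θ₂, θ₃]
  have hroot (i : Fin 8) : root (algebraMap k L m) (algebraMap k L A) s w y θ i =
      (algebraMap k L A + T i) / 4 + Θ i / 2 := by
    fin_cases i <;> simp [root, radicalRoot, T, Θ, hθ₂, hθ₃, hθ₄] <;> ring
  have hgroot (i : Fin 8) : g (root (algebraMap k L m) (algebraMap k L A) s w y θ i) =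
      (algebraMap k L A + T i) / 4 - Θ i / 2 := by
    rw [hroot]
    fin_cases i <;>
      simp [T, Θ, hg₂, hg₃, hg₄, hgs, hgw, hgθ, map_ofNat g, neg_div, sub_eq_add_neg]
  intro i j hij
  have hij' := congrArg g hij
  rw [hgroot, hgroot] at hij'
  rw [hroot, hroot] at hij
  have hT : T i = T j := by
    field_simp at hij hij'
    exact mul_left_cancel₀ h4 (by linear_combination hij + hij')
  have hΘ : Θ i = Θ j := by
    rw [hT] at hij
    simpa [h2] using hij
  have n₁ : -s + w ≠ s - w := fun e =>
    mul_ne_zero h2 (sub_ne_zero.2 hsw) (by linear_combination -e)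
  have n₂ : -s + w ≠ -s - w := fun e => mul_ne_zero h2 hw (by linear_combination e)
  have n₃ : -s + w ≠ s + w := fun e => mul_ne_zero h2 hs (by linear_combination -e)
  have n₄ : s - w ≠ -s - w := fun e => mul_ne_zero h2 hs (by linear_combination e)
  have n₅ : s - w ≠ s + w := fun e => mul_ne_zero h2 hw (by linear_combination -e)
  have n₆ : -s - w ≠ s + w := fun e => hsw' (mul_left_cancel₀ h2 (by linear_combination -e))
  have k₁ := ne_neg h.θ_ne
  have k₂ := ne_neg h.neg_w.θ_ne
  have k₃ := ne_neg h.neg_s.θ_ne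
  have k₄ := ne_neg h.neg_s_w_y.θ_ne
  rw [← hθ₂] at k₂
  rw [← hθ₃] at k₃
  rw [← hθ₄] at k₄
  clear_value θ₂ θ₃ θ₄
  clear hroot hgroot hij hij'
  fin_cases i <;> fin_cases j <;> first
    | rfl
    | exact (n₁ hT).elim
    | exact (n₁ hT.symm).elim
    | exact (n₂ hT).elim
    | exact (n₂ hT.symm).elim
    | exact (n₃ hT).elim
    | exact (n₃ hT.symm).elim
    | exact (n₄ hT).elim
    | exact (n₄ hT.symm).elim
    | exact (n₅ hT).elim
    | exact (n₅ hT.symm).elim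
    | exact (n₆ hT).elim
    | exact (n₆ hT.symm).elim
    | exact (k₁ hΘ).elim
    | exact (k₁ hΘ.symm).elim
    | exact (k₂ hΘ).elim
    | exact (k₂ hΘ.symm).elim
    | exact (k₃ hΘ).elim
    | exact (k₃ hΘ.symm).elim
    | exact (k₄ hΘ).elim
    | exact (k₄ hΘ.symm).elim

end

section

variable {k L : Type*} [Field k] [Field L] [Algebra k L] {m A : k} {s w y θ : L}

theorem map_root (g : L ≃ₐ[k] L) (i : Fin 8) :
    g (root (algebraMap k L m) (algebraMap k L A) s w y θ i) =
      root (algebraMap k L m) (algebraMap k L A) (g s) (g w) (g y) (g θ) i := by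
  fin_cases i <;> simp [root, radicalRoot, map_ofNat g]

end

section

variable {K : Type*} [Field K] {m A s w y θ : K} (h : OcticRadicals m A s w y θ)
include h

theorem root_perm8a (i : Fin 8) :
    root m A (-s) (-w) (-y) ((m - s - 2) * θ / (A + m + 2 + w)) i =
      root m A s w y θ (perm8a i) := by
  have h2 := h.two_ne
  have h3 := h.θ_ne
  have h4 := h.y_ne
  have h5 := h.add_w_ne
  have h6 := h.sub_w_ne
  have h7 := h.sub_s_ne
  have h8 := h.add_s_ne
  have e₁ : (m - -s - 2) * ((m - s - 2) * θ / (A + m + 2 + w)) / (A + m + 2 + -w) = -θ := by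
    rw [← sub_eq_add_neg (A + m + 2)]
    field_simp
    linear_combination -h.sq_s - h.sq_w
  have e₂ : (m + -s - 2) * -y / (2 * ((m - s - 2) * θ / (A + m + 2 + w))) =
      -((A + m + 2 + w) * y / (2 * θ)) := by
    field_simp
    ring
  have e₃ : (A + m + 2 + -w) * -y / (2 * ((m - s - 2) * θ / (A + m + 2 + w))) =
      (m + s - 2) * y / (2 * θ) := by
    field_simp
    linear_combination h.sq_s + h.sq_w
  simp only [root, e₁, e₂, e₃]
  simp only [neg_neg]
  exact cons_apply_perm8a _ _ _ _ _ _ _ _ i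

omit h in
theorem root_perm8b (i : Fin 8) : root m A s w (-y) θ i = root m A s w y θ (perm8b i) := by
  simp only [root, mul_neg, neg_div, neg_neg]
  exact cons_apply_perm8b _ _ _ _ _ _ _ _ i

theorem root_perm8c (i : Fin 8) :
    root m A s (-w) y ((m + s - 2) * y / (2 * θ)) i = root m A s w y θ (perm8c i) := by
  have h2 := h.two_ne
  have h3 := h.θ_ne
  have h4 := h.y_ne
  have h5 := h.add_w_ne
  have h6 := h.sub_w_ne
  have h7 := h.sub_s_ne
  have h8 := h.add_s_ne
  have e₁ : (m - s - 2) * ((m + s - 2) * y / (2 * θ)) / (A + m + 2 + -w) =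
      -((A + m + 2 + w) * y / (2 * θ)) := by
    rw [← sub_eq_add_neg (A + m + 2)]
    field_simp
    linear_combination -h.sq_s - h.sq_w
  have e₂ : (m + s - 2) * y / (2 * ((m + s - 2) * y / (2 * θ))) = θ := by
    field_simp
  have e₃ : (A + m + 2 + -w) * y / (2 * ((m + s - 2) * y / (2 * θ))) =
      -((m - s - 2) * θ / (A + m + 2 + w)) := by
    field_simp
    linear_combination -h.sq_s - h.sq_w
  simp only [root, e₁, e₂, e₃]
  simp only [neg_neg]
  exact cons_apply_perm8c _ _ _ _ _ _ _ _ i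

end

end OcticRadicals

/-! ### The Galois group as `8T11` -/

namespace OcticRadicals

variable {k L : Type*} [Field k] [Field L] [Algebra k L] {m A : k} {s w y θ : L}

theorem mem_rootSet_iff (h : OcticRadicals (algebraMap k L m) (algebraMap k L A) s w y θ) (x : L) :
    x ∈ (octic m A).rootSet L ↔
      ∃ i, root (algebraMap k L m) (algebraMap k L A) s w y θ i = x := by
  have hne : (octic m A).map (algebraMap k L) ≠ 0 := by
    rw [h.octic_map_eq_prod]
    exact Finset.prod_ne_zero_iff.2 fun i _ => X_sub_C_ne_zero _
  rw [mem_rootSet', aeval_def, eval₂_eq_eval_map, h.octic_map_eq_prod, eval_prod,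
    Finset.prod_eq_zero_iff, ← h.octic_map_eq_prod]
  simp [hne, sub_eq_zero, eq_comm (a := x)]

variable (h : OcticRadicals (algebraMap k L m) (algebraMap k L A) s w y θ)
  [IsGalois k L] (hE : Module.finrank k (adjoin k ({s, w, y} : Set L)) = 8)

/-- The numbering of the zeroes of the octic by `OcticRadicals.root`. -/
noncomputable def rootEquiv : Fin 8 ≃ (octic m A).rootSet L :=
  Equiv.ofBijective (fun i => ⟨root (algebraMap k L m) (algebraMap k L A) s w y θ i,
      (h.mem_rootSet_iff _).2 ⟨i, rfl⟩⟩)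
    ⟨fun _ _ hij => h.root_injective hE (congrArg Subtype.val hij),
      fun ⟨x, hx⟩ => ((h.mem_rootSet_iff x).1 hx).imp fun _ hi => Subtype.ext hi⟩

theorem coe_rootEquiv (i : Fin 8) : (h.rootEquiv hE i : L) =
    root (algebraMap k L m) (algebraMap k L A) s w y θ i :=
  rfl

/-- The action of the Galois group on the numbers of the zeroes of the octic. -/
noncomputable def permHom : (L ≃ₐ[k] L) →* Equiv.Perm (Fin 8) :=
  (h.rootEquiv hE).symm.permCongrHom.toMonoidHom.comp
    (MulAction.toPermHom (L ≃ₐ[k] L) ((octic m A).rootSet L))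

theorem rootEquiv_permHom (g : L ≃ₐ[k] L) (i : Fin 8) :
    (h.rootEquiv hE (h.permHom hE g i) : L) = g (h.rootEquiv hE i) := by
  change ((h.rootEquiv hE) ((h.rootEquiv hE).symm (g • h.rootEquiv hE i)) : L) = _
  rw [Equiv.apply_symm_apply]
  rfl

theorem permHom_eq_of_forall {g : L ≃ₐ[k] L} {σ : Equiv.Perm (Fin 8)}
    (hg : ∀ i, g (root (algebraMap k L m) (algebraMap k L A) s w y θ i) =
      root (algebraMap k L m) (algebraMap k L A) s w y θ (σ i)) : h.permHom hE g = σ := by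
  ext1 i
  refine (h.rootEquiv hE).injective (Subtype.ext ?_)
  rw [rootEquiv_permHom, coe_rootEquiv, coe_rootEquiv, hg]

include h hE

theorem exists_algEquiv_perm8a : ∃ g : L ≃ₐ[k] L,
    h.permHom hE g = perm8a ∧ g s = -s ∧ g w = -w ∧ g y = -y := by
  obtain ⟨g, hs, hw, hy, hθ⟩ := h.exists_algEquiv hE (p := -1) (q := -1) (r := -1) (θ' := _)
    (by simpa using h.neg_s_w_y)
  simp only [Units.val_neg, Units.val_one, Int.cast_neg, Int.cast_one, neg_mul, one_mul]
    at hs hw hy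
  refine ⟨g, h.permHom_eq_of_forall hE fun i => ?_, hs, hw, hy⟩
  rw [map_root, hs, hw, hy, hθ, h.root_perm8a]

theorem exists_algEquiv_perm8b : ∃ g : L ≃ₐ[k] L,
    h.permHom hE g = perm8b ∧ g s = s ∧ g w = w ∧ g y = -y := by
  obtain ⟨g, hs, hw, hy, hθ⟩ := h.exists_algEquiv hE (p := 1) (q := 1) (r := -1) (θ' := _)
    (by simpa using h.neg_y)
  simp only [Units.val_neg, Units.val_one, Int.cast_neg, Int.cast_one, neg_mul, one_mul]
    at hs hw hy
  refine ⟨g, h.permHom_eq_of_forall hE fun i => ?_, hs, hw, hy⟩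
  rw [map_root, hs, hw, hy, hθ, root_perm8b]

theorem exists_algEquiv_perm8c : ∃ g : L ≃ₐ[k] L,
    h.permHom hE g = perm8c ∧ g s = s ∧ g w = -w ∧ g y = y := by
  obtain ⟨g, hs, hw, hy, hθ⟩ := h.exists_algEquiv hE (p := 1) (q := -1) (r := 1) (θ' := _)
    (by simpa using h.neg_w)
  simp only [Units.val_neg, Units.val_one, Int.cast_neg, Int.cast_one, neg_mul, one_mul]
    at hs hw hy
  refine ⟨g, h.permHom_eq_of_forall hE fun i => ?_, hs, hw, hy⟩
  rw [map_root, hs, hw, hy, hθ, h.root_perm8c]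

section

variable [IsSplittingField k L (octic m A)]

omit [IsGalois k L] hE in
theorem eq_of_forall_root {g g' : L ≃ₐ[k] L}
    (hg : ∀ i, g (root (algebraMap k L m) (algebraMap k L A) s w y θ i) =
      g' (root (algebraMap k L m) (algebraMap k L A) s w y θ i)) : g = g' := by
  have := AlgHom.ext_of_adjoin_eq_top (φ₁ := (g : L →ₐ[k] L)) (φ₂ := (g' : L →ₐ[k] L))
    (IsSplittingField.adjoin_rootSet L (octic m A)) (fun x hx => by
      obtain ⟨i, rfl⟩ := (h.mem_rootSet_iff x).1 hx
      exact hg i)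
  exact AlgEquiv.ext fun x => DFunLike.congr_fun this x

theorem permHom_injective : Function.Injective (h.permHom hE) := by
  intro g g' hgg
  refine h.eq_of_forall_root fun i => ?_
  rw [← coe_rootEquiv h hE, ← rootEquiv_permHom, hgg, rootEquiv_permHom]

/-- An automorphism is determined by the three signs that it puts on `s`, `w`, `y`, together with a
choice of one of two opposite values at `θ`. -/
theorem card_le_sixteen : Nat.card (L ≃ₐ[k] L) ≤ 16 := by
  classical
  choose ref hs hw hy using exists_algEquiv_signCharacter h.sq_s' h.sq_w' h.sq_y' hE
  let F : (L ≃ₐ[k] L) → ℤˣ × ℤˣ × ℤˣ × Bool := fun g =>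
    (signCharacter s h.sq_s' g, signCharacter w h.sq_w' g, signCharacter y h.sq_y' g,
      decide (g θ = ref (signCharacter s h.sq_s' g) (signCharacter w h.sq_w' g)
        (signCharacter y h.sq_y' g) θ))
  have hF : Function.Injective F := by
    intro g g' hgg
    simp only [F, Prod.mk.injEq, decide_eq_decide] at hgg
    obtain ⟨h₁, h₂, h₃, h₄⟩ := hgg
    rw [← h₁, ← h₂, ← h₃] at h₄
    set g₀ := ref (signCharacter s h.sq_s' g) (signCharacter w h.sq_w' g)
      (signCharacter y h.sq_y' g)
    have es : g s = g₀ s ∧ g' s = g₀ s := by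
      simp only [apply_eq_signCharacter_mul _ h.sq_s', g₀, hs, h₁, and_self]
    have ew : g w = g₀ w ∧ g' w = g₀ w := by
      simp only [apply_eq_signCharacter_mul _ h.sq_w', g₀, hw, h₂, and_self]
    have ey : g y = g' y := by
      simp only [apply_eq_signCharacter_mul _ h.sq_y', h₃]
    have a₁ := h.map g
    have a₂ := h.map g'
    rw [es.1, ew.1] at a₁
    rw [es.2, ew.2] at a₂
    have eθ : g θ = g' θ := by
      by_cases hθ : g θ = g₀ θ
      · rw [hθ, h₄.1 hθ]
      · rw [(a₁.θ_eq_or_neg (h.map g₀)).resolve_left hθ,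
          (a₂.θ_eq_or_neg (h.map g₀)).resolve_left (mt h₄.2 hθ)]
    refine h.eq_of_forall_root fun i => ?_
    rw [map_root, map_root, es.1, es.2, ew.1, ew.2, ey, eθ]
  calc Nat.card (L ≃ₐ[k] L) ≤ Nat.card (ℤˣ × ℤˣ × ℤˣ × Bool) := Nat.card_le_card_of_injective F hF
    _ = 16 := by
      rw [Nat.card_eq_fintype_card]
      decide

theorem range_permHom [FiniteDimensional k L] : (h.permHom hE).range = eightT11 := by
  refine (Subgroup.eq_of_le_of_card_ge ?_ ?_).symm
  · obtain ⟨a, ha, -⟩ := h.exists_algEquiv_perm8a hE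
    obtain ⟨b, hb, -⟩ := h.exists_algEquiv_perm8b hE
    obtain ⟨c, hc, -⟩ := h.exists_algEquiv_perm8c hE
    rw [eightT11, Subgroup.closure_le]
    rintro _ (rfl | rfl | rfl)
    exacts [⟨a, ha⟩, ⟨b, hb⟩, ⟨c, hc⟩]
  · rw [← Nat.card_congr (MonoidHom.ofInjective (h.permHom_injective hE)).toEquiv, PauliGroup.card_eightT11]
    exact h.card_le_sixteen hE

variable [FiniteDimensional k L]

/-- The Galois group, as a group of permutations of the numbered zeroes of the octic. -/
noncomputable def galEquivEightT11 : (L ≃ₐ[k] L) ≃* eightT11 :=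
  (MonoidHom.ofInjective (h.permHom_injective hE)).trans
    (MulEquiv.subgroupCongr (h.range_permHom hE))

theorem coe_galEquivEightT11 (g : L ≃ₐ[k] L) :
    (h.galEquivEightT11 hE g : Equiv.Perm (Fin 8)) = h.permHom hE g :=
  rfl

/-- The Galois group is isomorphic to the Pauli group. -/
noncomputable def galEquivPauli : (L ≃ₐ[k] L) ≃* PauliGroup :=
  (h.galEquivEightT11 hE).trans PauliGroup.equivEightT11.symm

theorem galEquivPauli_symm_apply {n : PauliGroup} {g : L ≃ₐ[k] L}
    (hg : h.permHom hE g = PauliGroup.toPerm n) : (h.galEquivPauli hE).symm n = g := by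
  rw [MulEquiv.symm_apply_eq, galEquivPauli, MulEquiv.trans_apply, MulEquiv.eq_symm_apply]
  exact Subtype.ext hg.symm

/-- The subgroup fixing a square root `d` of an element of `k` is the kernel of the character given
by the signs that the generators `i`, `X`, `Z` put on `d`. -/
theorem map_fixingSubgroup {d : L} {c : k} (hd : d ^ 2 = algebraMap k L c) (hd0 : d ≠ 0)
    {p q r : ℤˣ} (hp : (h.galEquivPauli hE).symm .i d = ((p : ℤ) : L) * d)
    (hq : (h.galEquivPauli hE).symm .x d = ((q : ℤ) : L) * d)
    (hr : (h.galEquivPauli hE).symm .z d = ((r : ℤ) : L) * d) :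
    (k⟮d⟯.fixingSubgroup).map (h.galEquivPauli hE).toMonoidHom =
      (PauliGroup.character p q r).ker := by
  have h2 := h.two_ne
  have key {g : L ≃ₐ[k] L} {ε : ℤˣ} (hg : g d = ((ε : ℤ) : L) * d) : signCharacter d hd g = ε := by
    rcases Int.units_eq_one_or ε with rfl | rfl
    · rw [signCharacter_eq_one_iff, hg]
      simp
    · rw [signCharacter_eq_neg_one_iff, hg]
      intro e
      refine mul_ne_zero h2 hd0 ?_
      simp only [Units.val_neg, Units.val_one, Int.cast_neg, Int.cast_one] at e
      linear_combination -e
  have hχ := PauliGroup.eq_character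
    ((signCharacter d hd).comp (h.galEquivPauli hE).symm.toMonoidHom)
  simp only [MonoidHom.comp_apply, MulEquiv.toMonoidHom_eq_coe, MonoidHom.coe_coe, key hp, key hq,
    key hr] at hχ
  ext n
  rw [← hχ, MonoidHom.mem_ker, Subgroup.mem_map_equiv, MonoidHom.comp_apply,
    signCharacter_eq_one_iff, IntermediateField.mem_fixingSubgroup_iff]
  change (∀ x ∈ adjoin k _, (h.galEquivPauli hE).symm n • x = x) ↔ _
  rw [forall_mem_adjoin_smul_eq_self_iff]
  simp

theorem galEquivPauli_symm_i : (h.galEquivPauli hE).symm .i s = -s ∧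
    (h.galEquivPauli hE).symm .i w = -w ∧ (h.galEquivPauli hE).symm .i y = -y := by
  obtain ⟨g, hg, hg'⟩ := h.exists_algEquiv_perm8a hE
  rwa [h.galEquivPauli_symm_apply hE (n := .i) (g := g) (by rw [hg]; decide +kernel)]

theorem galEquivPauli_symm_x : (h.galEquivPauli hE).symm .x s = s ∧
    (h.galEquivPauli hE).symm .x w = -w ∧ (h.galEquivPauli hE).symm .x y = y := by
  obtain ⟨g, hg, hg'⟩ := h.exists_algEquiv_perm8c hE
  rwa [h.galEquivPauli_symm_apply hE (n := .x) (g := g) (by rw [hg]; decide +kernel)]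

theorem galEquivPauli_symm_z : (h.galEquivPauli hE).symm .z s = s ∧
    (h.galEquivPauli hE).symm .z w = w ∧ (h.galEquivPauli hE).symm .z y = -y := by
  obtain ⟨g, hg, hg'⟩ := h.exists_algEquiv_perm8b hE
  rwa [h.galEquivPauli_symm_apply hE (n := .z) (g := g) (by rw [hg]; decide +kernel)]

theorem card_algEquiv : Nat.card (L ≃ₐ[k] L) = 16 := by
  rw [Nat.card_congr (h.galEquivPauli hE).toEquiv, PauliGroup.card_eq]

/-- The minimal polynomial of a zero of the octic vanishes at all eight zeroes, because the Galois
group permutes them transitively; hence it is the octic. -/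
theorem irreducible_octic : Irreducible (octic m A) := by
  have hinj := (algebraMap k L).injective
  have hmonic : (octic m A).Monic := by
    rw [hinj.monic_map_iff, h.octic_map_eq_prod]
    exact monic_prod_of_monic _ _ fun i _ => monic_X_sub_C _
  have hdeg : (octic m A).natDegree = 8 := by
    rw [← natDegree_map (algebraMap k L), h.octic_map_eq_prod,
      natDegree_prod_of_monic _ _ fun i _ => monic_X_sub_C _]
    simp
  set x := root (algebraMap k L m) (algebraMap k L A) s w y θ 0 with hx
  have hint : IsIntegral k x := Algebra.IsIntegral.isIntegral x
  have hroot (i : Fin 8) : aeval (root (algebraMap k L m) (algebraMap k L A) s w y θ i)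
      (minpoly k x) = 0 := by
    have htrans : ∀ i : Fin 8, ∃ n : PauliGroup, PauliGroup.toPerm n 0 = i := by decide +kernel
    obtain ⟨n, hn⟩ := htrans i
    have hg := h.rootEquiv_permHom hE ((h.galEquivPauli hE).symm n) 0
    have hperm : h.permHom hE ((h.galEquivPauli hE).symm n) = PauliGroup.toPerm n := by
      rw [← h.coe_galEquivEightT11 hE, galEquivPauli]
      simp only [MulEquiv.symm_trans_apply, MulEquiv.symm_symm, MulEquiv.apply_symm_apply]
      rfl
    rw [hperm, hn, coe_rootEquiv, coe_rootEquiv, ← hx] at hg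
    rw [hg, aeval_algHom_apply, minpoly.aeval, map_zero]
  have hle : 8 ≤ (minpoly k x).natDegree := by
    by_contra! hlt
    refine (minpoly.monic hint).map (algebraMap k L) |>.ne_zero
      (eq_zero_of_natDegree_lt_card_of_eval_eq_zero _ (h.root_injective hE)
        (fun i => ?_) ?_)
    · rw [eval_map_algebraMap, hroot]
    · rwa [natDegree_map, Fintype.card_fin]
  have hdvd : minpoly k x ∣ octic m A := by
    refine minpoly.dvd k x ?_
    exact ((mem_rootSet'.1 ((h.mem_rootSet_iff x).2 ⟨0, rfl⟩)).2)
  rw [eq_of_monic_of_dvd_of_natDegree_le (minpoly.monic hint) hmonic hdvd (hdeg ▸ hle)]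
  exact minpoly.irreducible hint

end

end OcticRadicals

/-! ### Passage to the splitting field inside the algebraically closed field -/

section

variable {k Ω : Type*} [Field k] [Field Ω] [Algebra k Ω]

theorem finrank_adjoin_coe (L : IntermediateField k Ω) (s w y : L) :
    Module.finrank k (adjoin k ({s, w, y} : Set L)) =
      Module.finrank k (adjoin k ({(s : Ω), (w : Ω), (y : Ω)} : Set Ω)) := by
  have : lift (adjoin k ({s, w, y} : Set L)) =
      adjoin k ({(s : Ω), (w : Ω), (y : Ω)} : Set Ω) := by
    rw [lift_adjoin, Set.image_insert_eq, Set.image_insert_eq, Set.image_singleton]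
  rw [← this]
  exact (liftAlgEquiv _).toLinearEquiv.finrank_eq

/-- Away from characteristic two, the separable closure is closed under square roots. -/
theorem mem_separableClosure_of_sq [IsAlgClosed Ω] (h2 : (2 : k) ≠ 0) {z : Ω}
    (hz : z ^ 2 ∈ separableClosure k Ω) : z ∈ separableClosure k Ω := by
  have : IsSepClosed (separableClosure k Ω) := IsSepClosure.sep_closed k
  have : NeZero ((2 : ℕ) : separableClosure k Ω) := by
    refine ⟨fun e => h2 ?_⟩
    apply (algebraMap k (separableClosure k Ω)).injective
    simpa [map_ofNat (algebraMap k (separableClosure k Ω))] using e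
  obtain ⟨x, hx⟩ := IsSepClosed.exists_pow_nat_eq (⟨z ^ 2, hz⟩ : separableClosure k Ω) 2
  have hx' : (x : Ω) ^ 2 = z ^ 2 := congrArg Subtype.val hx
  rcases sq_eq_sq_iff_eq_or_eq_neg.1 hx' with e | e
  · exact e ▸ x.2
  · rw [← neg_eq_iff_eq_neg.2 e]
    exact neg_mem x.2

/-- The square roots `s`, `w`, `y` are complemented by a suitable `θ`. -/
theorem exists_octicRadicals [IsAlgClosed Ω] {m A : k} {s w y : Ω}
    (hs : s ^ 2 = algebraMap k Ω (m ^ 2 - 4))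
    (hw : w ^ 2 = algebraMap k Ω ((m + 2 + A) ^ 2 - 4 * (m - 2)))
    (hy : y ^ 2 = algebraMap k Ω (A ^ 2 - 4 * (m - 2)))
    (hE : Module.finrank k (adjoin k ({s, w, y} : Set Ω)) = 8) :
    ∃ θ : Ω, OcticRadicals (algebraMap k Ω m) (algebraMap k Ω A) s w y θ ∧
      s ∈ separableClosure k Ω ∧ w ∈ separableClosure k Ω ∧ y ∈ separableClosure k Ω ∧
      θ ∈ separableClosure k Ω := by
  have h2 := two_ne_zero_of_finrank hs hw hy hE
  have h2' : (2 : Ω) ≠ 0 := by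
    rw [← map_ofNat (algebraMap k Ω) 2]
    exact (_root_.map_ne_zero _).2 h2
  have h4' : (4 : Ω) ≠ 0 := by
    rw [show (4 : Ω) = 2 * 2 by norm_num]
    exact mul_ne_zero h2' h2'
  have mem {d : Ω} {c : k} (hd : d ^ 2 = algebraMap k Ω c) : d ∈ separableClosure k Ω :=
    mem_separableClosure_of_sq h2 (hd ▸ IntermediateField.algebraMap_mem _ _)
  obtain ⟨hm, hy0⟩ := m_ne_two_and_y_ne_zero (F := separableClosure k Ω) (s := ⟨s, mem hs⟩)
    (w := ⟨w, mem hw⟩) (y := ⟨y, mem hy⟩) (Subtype.ext hs) (Subtype.ext hw) (Subtype.ext hy)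
    (by rw [finrank_adjoin_coe, hE])
  obtain ⟨θ, hθ⟩ := IsAlgClosed.exists_pow_nat_eq
    (((algebraMap k Ω A - s + w) ^ 2 - 8 * (algebraMap k Ω m + s)) / 4) two_pos
  refine ⟨θ, ⟨h2', ?_, ?_, ?_, ?_, ?_, ?_⟩, mem hs, mem hw, mem hy,
    mem_separableClosure_of_sq h2 ?_⟩
  · rw [← map_ofNat (algebraMap k Ω) 2]
    exact (algebraMap k Ω).injective.ne hm
  · exact fun e => hy0 (Subtype.ext e)
  · simpa [map_ofNat (algebraMap k Ω)] using hs
  · simpa [map_ofNat (algebraMap k Ω)] using hw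
  · simpa [map_ofNat (algebraMap k Ω)] using hy
  · rw [hθ]
    field_simp
  · rw [hθ]
    have hS (c : k) := IntermediateField.algebraMap_mem (separableClosure k Ω) c
    exact div_mem (sub_mem (pow_mem (add_mem (sub_mem (hS A) (mem hs)) (mem hw)) 2)
      (mul_mem (ofNat_mem _ 8) (add_mem (hS m) (mem hs)))) (ofNat_mem _ 4)

namespace OcticRadicals

variable {m A : k} {s w y θ : Ω}
  (h : OcticRadicals (algebraMap k Ω m) (algebraMap k Ω A) s w y θ)
include h

/-- The zeroes of the octic lie in `k(s, w, y, θ)`. -/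
theorem rootSet_subset {M : IntermediateField k Ω} (hs : s ∈ M) (hw : w ∈ M) (hy : y ∈ M)
    (hθ : θ ∈ M) : (octic m A).rootSet Ω ⊆ M := by
  have hM (c : k) := IntermediateField.algebraMap_mem M c
  have hroot {a b c : Ω} (ha : a ∈ M) (hb : b ∈ M) (hc : c ∈ M) :
      radicalRoot (algebraMap k Ω A) a b c ∈ M :=
    add_mem (div_mem (add_mem (sub_mem (hM A) ha) hb) (ofNat_mem _ 4))
      (div_mem hc (ofNat_mem _ 2))
  have h₂ : (algebraMap k Ω m + s - 2) * y / (2 * θ) ∈ M :=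
    div_mem (mul_mem (sub_mem (add_mem (hM m) hs) (ofNat_mem _ 2)) hy) (mul_mem (ofNat_mem _ 2) hθ)
  have h₃ : (algebraMap k Ω A + algebraMap k Ω m + 2 + w) * y / (2 * θ) ∈ M :=
    div_mem (mul_mem (add_mem (add_mem (add_mem (hM A) (hM m)) (ofNat_mem _ 2)) hw) hy)
      (mul_mem (ofNat_mem _ 2) hθ)
  have h₄ : (algebraMap k Ω m - s - 2) * θ /
      (algebraMap k Ω A + algebraMap k Ω m + 2 + w) ∈ M :=
    div_mem (mul_mem (sub_mem (sub_mem (hM m) hs) (ofNat_mem _ 2)) hθ)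
      (add_mem (add_mem (add_mem (hM A) (hM m)) (ofNat_mem _ 2)) hw)
  intro x hx
  obtain ⟨i, rfl⟩ := (h.mem_rootSet_iff x).1 hx
  fin_cases i
  · exact hroot hs hw hθ
  · exact hroot (neg_mem hs) (neg_mem hw) h₄
  · exact hroot hs hw (neg_mem hθ)
  · exact hroot (neg_mem hs) (neg_mem hw) (neg_mem h₄)
  · exact hroot hs (neg_mem hw) h₂
  · exact hroot (neg_mem hs) hw (neg_mem h₃)
  · exact hroot hs (neg_mem hw) (neg_mem h₂)
  · exact hroot (neg_mem hs) hw h₃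

/-- Sums and differences of zeroes recover `θ`, `t = (A - s ± w) / 2` and the conjugate
`(u - 1) * y / θ` of `θ`, hence `s`, `w`, `y`. -/
theorem mem_octicSplittingField : s ∈ octicSplittingField Ω m A ∧ w ∈ octicSplittingField Ω m A ∧
    y ∈ octicSplittingField Ω m A ∧ θ ∈ octicSplittingField Ω m A := by
  set M := octicSplittingField Ω m A
  have h2 := h.two_ne
  have h4 := h.four_ne
  have hM (c : k) := IntermediateField.algebraMap_mem M c
  have h2M : (2 : Ω) ∈ M := ofNat_mem _ 2
  have hr (i : Fin 8) : root (algebraMap k Ω m) (algebraMap k Ω A) s w y θ i ∈ M :=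
    subset_adjoin _ _ ((h.mem_rootSet_iff _).2 ⟨i, rfl⟩)
  have h₀ : radicalRoot (algebraMap k Ω A) s w θ ∈ M := hr 0
  have h₂ : radicalRoot (algebraMap k Ω A) s w (-θ) ∈ M := hr 2
  have h₄ : radicalRoot (algebraMap k Ω A) s (-w) ((algebraMap k Ω m + s - 2) * y / (2 * θ)) ∈ M :=
    hr 4
  have h₆ : radicalRoot (algebraMap k Ω A) s (-w)
      (-((algebraMap k Ω m + s - 2) * y / (2 * θ))) ∈ M := hr 6
  have hθ : θ ∈ M := by
    convert sub_mem h₀ h₂ using 1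
    unfold radicalRoot
    field_simp
    ring
  have ht : (algebraMap k Ω A - s + w) / 2 ∈ M := by
    convert add_mem h₀ h₂ using 1
    unfold radicalRoot
    field_simp
    ring
  have ht' : (algebraMap k Ω A - s - w) / 2 ∈ M := by
    convert add_mem h₄ h₆ using 1
    unfold radicalRoot
    field_simp
    ring
  have hw : w ∈ M := by
    convert sub_mem ht ht' using 1
    field_simp
    ring
  have hs : s ∈ M := by
    convert sub_mem (hM A) (add_mem ht ht') using 1
    field_simp
    ring
  have hθ' : (algebraMap k Ω m + s - 2) * y / (2 * θ) ∈ M := by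
    convert sub_mem h₄ h₆ using 1
    unfold radicalRoot
    field_simp
    ring
  refine ⟨hs, hw, ?_, hθ⟩
  convert div_mem (mul_mem hθ' (mul_mem h2M hθ)) (sub_mem (add_mem (hM m) hs) h2M) using 1
  have := h.add_s_ne
  have := h.θ_ne
  field_simp

end OcticRadicals

end

/-! ### The Galois correspondence for the quadratic subfields -/

namespace OcticRadicals

variable {k Ω : Type*} [Field k] [Field Ω] [Algebra k Ω] {m A : k}
  {L : IntermediateField k Ω} {s w y θ : L}
  (h : OcticRadicals (algebraMap k L m) (algebraMap k L A) s w y θ)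
  [IsGalois k L] (hE : Module.finrank k (adjoin k ({s, w, y} : Set L)) = 8)
  [IsSplittingField k L (octic m A)] [FiniteDimensional k L]

/-- The Galois correspondence for the quadratic subfields, in terms of the characters of the Pauli
group. -/
theorem map_eq_ker_iff {d : L} {c : k} (hd : d ^ 2 = algebraMap k L c) (hd0 : d ≠ 0)
    {p q r : ℤˣ} (hp : (h.galEquivPauli hE).symm .i d = ((p : ℤ) : L) * d)
    (hq : (h.galEquivPauli hE).symm .x d = ((q : ℤ) : L) * d)
    (hr : (h.galEquivPauli hE).symm .z d = ((r : ℤ) : L) * d) (H : Subgroup (L ≃ₐ[k] L)) :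
    H.map (h.galEquivPauli hE).toMonoidHom = (PauliGroup.character p q r).ker ↔
      lift (fixedField H) = k⟮(d : Ω)⟯ := by
  rw [← h.map_fixingSubgroup hE hd hd0 hp hq hr, ← lift_adjoin_simple, lift_inj,
    (Subgroup.map_injective (h.galEquivPauli hE).injective).eq_iff]
  constructor
  · rintro rfl
    exact IsGalois.fixedField_fixingSubgroup _
  · intro e
    rw [← e, fixingSubgroup_fixedField]

end OcticRadicals

theorem theoremt {k : Type*} [Field k] {Ω : Type*} [Field Ω] [Algebra k Ω] [IsAlgClosed Ω]
    (m A : k) (s w y : Ω)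
    (hs : s ^ 2 = algebraMap k Ω (m ^ 2 - 4))
    (hw : w ^ 2 = algebraMap k Ω ((m + 2 + A) ^ 2 - 4 * (m - 2)))
    (hy : y ^ 2 = algebraMap k Ω (A ^ 2 - 4 * (m - 2)))
    (hE : Module.finrank k (IntermediateField.adjoin k ({s, w, y} : Set Ω)) = 8) :
    -- the octic is irreducible over `k`
    Irreducible (octic m A) ∧
    -- its splitting field `L` is Galois over `k`, with group of order 16
    IsGalois k (octicSplittingField Ω m A) ∧
    Nat.card (octicSplittingField Ω m A ≃ₐ[k] octicSplittingField Ω m A) = 16 ∧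
    -- the Galois group is `8T11`, as a group of permutations of the zeroes
    (∃ (e : Fin 8 ≃ (octic m A).rootSet (octicSplittingField Ω m A))
        (φ : (octicSplittingField Ω m A ≃ₐ[k] octicSplittingField Ω m A) ≃* eightT11),
        ∀ (g : octicSplittingField Ω m A ≃ₐ[k] octicSplittingField Ω m A) (i : Fin 8),
          (e ((φ g : Equiv.Perm (Fin 8)) i) : octicSplittingField Ω m A) = g (e i)) ∧
    -- there is one quaternion subgroup, and its fixed field is `k(swy)`
    {H : Subgroup (octicSplittingField Ω m A ≃ₐ[k] octicSplittingField Ω m A) |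
        Nonempty (H ≃* QuaternionGroup 2)}.ncard = 1 ∧
    (∀ H : Subgroup (octicSplittingField Ω m A ≃ₐ[k] octicSplittingField Ω m A),
        Nonempty (H ≃* QuaternionGroup 2) ↔
          IntermediateField.lift (IntermediateField.fixedField H) = k⟮s * w * y⟯) ∧
    -- there are three subgroups `D₄`, and their fixed fields are `k(s)`, `k(w)`, `k(y)`
    {H : Subgroup (octicSplittingField Ω m A ≃ₐ[k] octicSplittingField Ω m A) |
        Nonempty (H ≃* DihedralGroup 4)}.ncard = 3 ∧
    (∀ H : Subgroup (octicSplittingField Ω m A ≃ₐ[k] octicSplittingField Ω m A),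
        Nonempty (H ≃* DihedralGroup 4) ↔
          (IntermediateField.lift (IntermediateField.fixedField H) = k⟮s⟯ ∨
            IntermediateField.lift (IntermediateField.fixedField H) = k⟮w⟯ ∨
            IntermediateField.lift (IntermediateField.fixedField H) = k⟮y⟯)) ∧
    -- there are three subgroups `C₄ × C₂`, and their fixed fields are `k(sw)`, `k(sy)`, `k(wy)`
    {H : Subgroup (octicSplittingField Ω m A ≃ₐ[k] octicSplittingField Ω m A) |
        Nonempty (H ≃* Multiplicative (ZMod 4) × Multiplicative (ZMod 2))}.ncard = 3 ∧
    (∀ H : Subgroup (octicSplittingField Ω m A ≃ₐ[k] octicSplittingField Ω m A),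
        Nonempty (H ≃* Multiplicative (ZMod 4) × Multiplicative (ZMod 2)) ↔
          (IntermediateField.lift (IntermediateField.fixedField H) = k⟮s * w⟯ ∨
            IntermediateField.lift (IntermediateField.fixedField H) = k⟮s * y⟯ ∨
            IntermediateField.lift (IntermediateField.fixedField H) = k⟮w * y⟯)) := by
  obtain ⟨θ, h, hsS, hwS, hyS, hθS⟩ := exists_octicRadicals hs hw hy hE
  set L := octicSplittingField Ω m A with hL
  have hsplit : IsSplittingField k L (octic m A) :=
    adjoin_rootSet_isSplittingField (IsAlgClosed.splits _)
  have hfin : FiniteDimensional k L := IsSplittingField.finiteDimensional L (octic m A)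
  have hnormal : Normal k L := Normal.of_isSplittingField (octic m A)
  -- `L` is separable because it is generated by iterated square roots, away from characteristic two.
  have hsep : Algebra.IsSeparable k L :=
    (le_separableClosure_iff k Ω L).1 (adjoin_le_iff.2 (h.rootSet_subset hsS hwS hyS hθS))
  have hgal : IsGalois k L := ⟨⟩
  obtain ⟨hsL, hwL, hyL, hθL⟩ := h.mem_octicSplittingField
  lift s to L using hsL
  lift w to L using hwL
  lift y to L using hyL
  lift θ to L using hθL
  rw [← finrank_adjoin_coe] at hE
  have h' : OcticRadicals (algebraMap k L m) (algebraMap k L A) s w y θ :=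
    { two_ne := fun e => h.two_ne (congrArg Subtype.val e)
      m_ne := fun e => h.m_ne (congrArg Subtype.val e)
      y_ne := fun e => h.y_ne (congrArg Subtype.val e)
      sq_s := Subtype.ext h.sq_s
      sq_w := Subtype.ext h.sq_w
      sq_y := Subtype.ext h.sq_y
      sq_θ := Subtype.ext h.sq_θ }
  set f := h'.galEquivPauli hE with hf
  obtain ⟨is, iw, iy⟩ := h'.galEquivPauli_symm_i hE
  obtain ⟨xs, xw, xy⟩ := h'.galEquivPauli_symm_x hE
  obtain ⟨zs, zw, zy⟩ := h'.galEquivPauli_symm_z hE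
  obtain ⟨hs0, hw0, -⟩ := h'.ne_zero_and_ne hE
  have hy0 : y ≠ 0 := h'.y_ne
  have hsq {d e : L} {a b : k} (hd : d ^ 2 = algebraMap k L a) (he : e ^ 2 = algebraMap k L b) :
      (d * e) ^ 2 = algebraMap k L (a * b) := by
    rw [mul_pow, hd, he, map_mul]
  have qs := h'.sq_s'
  have qw := h'.sq_w'
  have qy := h'.sq_y'
  refine ⟨h'.irreducible_octic hE, hgal, h'.card_algEquiv hE,
    ⟨h'.rootEquiv hE, h'.galEquivEightT11 hE, fun g i => h'.rootEquiv_permHom hE g i⟩,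
    ?_, fun H => ?_, ?_, fun H => ?_, ?_, fun H => ?_⟩
  · rw [PauliGroup.ncard_subgroup_mulEquiv f, PauliGroup.ncard_quaternion]
  · rw [← PauliGroup.nonempty_map_mulEquiv_iff f, PauliGroup.nonempty_mulEquiv_quaternion_iff]
    exact h'.map_eq_ker_iff hE (hsq (hsq qs qw) qy) (mul_ne_zero (mul_ne_zero hs0 hw0) hy0)
      (by simp [is, iw, iy]) (by simp [xs, xw, xy]) (by simp [zs, zw, zy]) H
  · rw [PauliGroup.ncard_subgroup_mulEquiv f, PauliGroup.ncard_dihedral]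
  · rw [← PauliGroup.nonempty_map_mulEquiv_iff f, PauliGroup.nonempty_mulEquiv_dihedral_iff]
    exact or_congr
      (h'.map_eq_ker_iff hE qs hs0 (by simp [is]) (by simp [xs]) (by simp [zs]) H) (or_congr
      (h'.map_eq_ker_iff hE qw hw0 (by simp [iw]) (by simp [xw]) (by simp [zw]) H)
      (h'.map_eq_ker_iff hE qy hy0 (by simp [iy]) (by simp [xy]) (by simp [zy]) H))
  · rw [PauliGroup.ncard_subgroup_mulEquiv f, PauliGroup.ncard_four_two]
  · rw [← PauliGroup.nonempty_map_mulEquiv_iff f, PauliGroup.nonempty_mulEquiv_four_two_iff]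
    exact or_congr
      (h'.map_eq_ker_iff hE (hsq qs qw) (mul_ne_zero hs0 hw0) (by simp [is, iw])
        (by simp [xs, xw]) (by simp [zs, zw]) H) (or_congr
      (h'.map_eq_ker_iff hE (hsq qs qy) (mul_ne_zero hs0 hy0) (by simp [is, iy])
        (by simp [xs, xy]) (by simp [zs, zy]) H)
      (h'.map_eq_ker_iff hE (hsq qw qy) (mul_ne_zero hw0 hy0) (by simp [iw, iy])
        (by simp [xw, xy]) (by simp [zw, zy]) H))
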